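/- **Setting.** Let $U\subset\mathbb R^3$ be open with coordinates $(x,y,u)$, let $\varphi:U\to\mathbb R$ be of class $\mathcal C^6$, and consider the real hypersurface $v=\varphi(x,y,u)$ of $\mathbb C^2$ with coordinates $z=x+iy$, $w=u+iv$. Put $$H_1=\partial_x+\frac{\varphi_y-\varphi_x\varphi_u}{1+\varphi_u^2}\,\partial_u,\qquad H_2=\partial_y+\frac{-\varphi_x-\varphi_y\varphi_u}{1+\varphi_u^2}\,\partial_u,\qquad T=\tfrac14[H_1,H_2].$$ Assume that the hypersurface is Levi nondegenerate over $U$: $H_1,H_2,[H_1,H_2]$ are linearly independent at every point of $U$. Define functions $\Phi_1,\Phi_2$ on $U$ by $[H_1,T]=\Phi_1T$ and $[H_2,T]=\Phi_2T$. **Lie algebra.** Let $\mathfrak g$ be the real Lie algebra with basis $\mathsf t,\mathsf h_1,\mathsf h_2,\mathsf d,\mathsf r,\mathsf i_1,\mathsf i_2,\mathsf j$ of degrees $-2,-1,-1,0,0,1,1,2$ and nonzero brackets $[\mathsf t,\mathsf d]=2\mathsf t$, $[\mathsf t,\mathsf i_1]=\mathsf h_1$, $[\mathsf t,\mathsf i_2]=\mathsf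 h_2$, $[\mathsf t,\mathsf j]=\mathsf d$, $[\mathsf h_1,\mathsf h_2]=4\mathsf t$, $[\mathsf h_1,\mathsf d]=\mathsf h_1$, $[\mathsf h_1,\mathsf r]=\mathsf h_2$, $[\mathsf h_1,\mathsf i_1]=6\mathsf r$, $[\mathsf h_1,\mathsf i_2]=2\mathsf d$, $[\mathsf h_1,\mathsf j]=\mathsf i_1$, $[\mathsf h_2,\mathsf d]=\mathsf h_2$, $[\mathsf h_2,\mathsf r]=-\mathsf h_1$, $[\mathsf h_2,\mathsf i_1]=-2\mathsf d$, $[\mathsf h_2,\mathsf i_2]=6\mathsf r$, $[\mathsf h_2,\mathsf j]=\mathsf i_2$, $[\mathsf d,\mathsf i_1]=\mathsf i_1$, $[\mathsf d,\mathsf i_2]=\mathsf i_2$, $[\mathsf d,\mathsf j]=2\mathsf j$, $[\mathsf r,\mathsf i_1]=-\mathsf i_2$, $[\mathsf r,\mathsf i_2]=\mathsf i_1$, $[\mathsf i_1,\mathsf i_2]=4\mathsf j$. Let $\mathfrak g_k$ be its component of degree $k$, $\mathfrak g_-=\mathfrak g_{-2}\oplus\mathfrak g_{-1}$ and $\mathfrak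 h=\mathfrak g_0\oplus\mathfrak g_1\oplus\mathfrak g_2$. The elements of $\mathfrak g_1\oplus\mathfrak g_2$ dual to $\mathsf v_1=\mathsf t,\ \mathsf v_2=\mathsf h_1,\ \mathsf v_3=\mathsf h_2$ for the Killing form are $\mathsf v_1^*=-\frac16\mathsf j$, $\mathsf v_2^*=-\frac1{24}\mathsf i_2$, $\mathsf v_3^*=\frac1{24}\mathsf i_1$. For an alternating $\Psi\in\Lambda^2(\mathfrak g/\mathfrak h)^*\otimes\mathfrak g=\Lambda^2\mathfrak g_-^*\otimes\mathfrak g$ and $z\in\mathfrak g_-$ put $$(\partial^*\Psi)(z)=\sum_{i=1}^3[\mathsf v_i^*,\Psi(\mathsf v_i,z)]+\frac12\sum_{i=1}^3\Psi\big(\mathrm{proj}_{\mathfrak g_-}[\mathsf v_i^*,z],\mathsf v_i\big),$$ where $\mathrm{proj}_{\mathfrak g_-}$ is the projection along $\mathfrak h$; and let $\Psi_{[h]}$ be the component of homogeneity $h$, i.e. for $x\in\mathfrak g_i,y\in\mathfrak g_j$ with $i,j<0$, $\Psi_{[h]}(x,y)$ is the $\mathfrak g_{i+j+h}$-component of $\Psi(x,y)$.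 **Bundle and frame.** Let $\mathcal P=U\times\{(a,b,c,d,e)\in\mathbb R^5: c^2+d^2\neq0\}$, regard $T,H_1,H_2$ as vector fields on $\mathcal P$, and let $D=-a\partial_a-b\partial_b-c\partial_c-d\partial_d-2e\partial_e$, $R=-b\partial_a+a\partial_b+d\partial_c-c\partial_d$, $I_1=\partial_a-b\partial_e$, $I_2=\partial_b+a\partial_e$, $J=\frac12\partial_e$. **The connection.** Write $r=c^2+d^2$, $s=a^2+b^2$ and - $P=H_1(\Phi_1)+H_2(\Phi_2)$, - $K_1=\Phi_1P-H_1H_1\Phi_1-5H_1H_2\Phi_2+4H_2H_1\Phi_2$, $\quad K_2=\Phi_2P-H_2H_2\Phi_2-5H_2H_1\Phi_1+4H_1H_1\Phi_2$, - $M_1=\Phi_2P-H_2H_2\Phi_2+7H_2H_1\Phi_1-8H_1H_1\Phi_2$, $\quad M_2=-\Phi_1P+H_1H_1\Phi_1-7H_1H_2\Phi_2+8H_2H_1\Phi_2$, - $N_1=\Phi_1P-H_1H_1\Phi_1-H_1H_2\Phi_2$, $\quad N_2=-\Phi_2P+H_2H_1\Phi_1+H_2H_2\Phi_2$, - $Q=\frac1{384}(H_1^3\Phi_1+H_2^3\Phi_2)-\frac7{384}(H_1H_1H_2\Phi_2+H_2H_2H_1\Phi_1)+\frac1{48}(H_1H_2H_1\Phi_2+H_2H_1H_1\Phi_2)-\frac1{192}(\Phi_1H_1H_1\Phi_1+\Phi_2H_2H_2\Phi_2)+\frac1{64}(\Phi_1H_1H_2\Phi_2+\Phi_2H_2H_1\Phi_1)-\frac1{48}(\Phi_1H_2H_1\Phi_2+\Phi_2H_1H_1\Phi_2)+\frac1{384}(\Phi_1^2+\Phi_2^2)P-\frac{11}{3072}P^2$.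 Let $\omega_p^{-1}:\mathfrak g\to T_p\mathcal P$ be the linear map that sends $\mathsf t,\mathsf h_1,\mathsf h_2,\mathsf d,\mathsf r,\mathsf i_1,\mathsf i_2,\mathsf j$ to the values at $p$ of $$\begin{aligned}\widehat T&=rT+(bd-ac)H_1-(ad+bc)H_2+\alpha_{td}D+\alpha_{tr}R+\alpha_{ti_1}I_1+\alpha_{ti_2}I_2+\alpha_{tj}J,\\ \widehat H_1&=cH_1+dH_2+\alpha_{h_1d}D+\alpha_{h_1r}R+\alpha_{h_1i_1}I_1+\alpha_{h_1i_2}I_2+\alpha_{h_1j}J,\\ \widehat H_2&=-dH_1+cH_2+\alpha_{h_2d}D+\alpha_{h_2r}R+\alpha_{h_2i_1}I_1+\alpha_{h_2i_2}I_2+\alpha_{h_2j}J,\end{aligned}$$ $\widehat D=D$, $\widehat R=R$, $\widehat I_1=I_1$, $\widehat I_2=I_2$, $\widehat J=J$, where - $\alpha_{td}=\frac12(bd-ac)\Phi_1-\frac12(bc+ad)\Phi_2-2e$, - $\alpha_{tr}=\frac1{32}Pr-\frac12(ad+bc)\Phi_1+\frac12(ac-bd)\Phi_2+3a^2+3b^2$,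 - $\alpha_{ti_1}=\frac1{192}(K_1c+K_2d)r+\frac1{16}Pbr-\frac12(\Phi_1c+\Phi_2d)s+2bs$, - $\alpha_{ti_2}=\frac1{192}(K_2c-K_1d)r-\frac1{16}Par-\frac12(\Phi_2c-\Phi_1d)s-2as$, - $\alpha_{tj}=Qr^2+\frac1{32}\big(N_2(ac-bd)+N_1(ad+bc)\big)r+\frac3{16}Psr+\big(\Phi_2(ac-bd)-\Phi_1(ad+bc)\big)s-2e\big(\Phi_1(ac-bd)+\Phi_2(ad+bc)\big)+3s^2-4e^2$, - $\alpha_{h_1d}=-2b+\frac12\Phi_1c+\frac12\Phi_2d$, $\quad\alpha_{h_1r}=-6a-\frac12\Phi_2c+\frac12\Phi_1d$, - $\alpha_{h_1i_1}=\frac12(bd+ac)\Phi_1-\frac12(bc-ad)\Phi_2-4ab-2e$, - $\alpha_{h_1i_2}=\frac1{32}Pr+\frac12(bc-ad)\Phi_1+\frac12(ac+bd)\Phi_2+3a^2-b^2$, - $\alpha_{h_1j}=\frac1{96}(M_1c+M_2d)r-\frac18Par-(\Phi_2c-\Phi_1d)s+2e(\Phi_1c+\Phi_2d)-8be-4as$,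 - $\alpha_{h_2d}=2a+\frac12\Phi_2c-\frac12\Phi_1d$, $\quad\alpha_{h_2r}=-6b+\frac12\Phi_1c+\frac12\Phi_2d$, - $\alpha_{h_2i_1}=-\frac1{32}Pr+\frac12(bc-ad)\Phi_1+\frac12(ac+bd)\Phi_2+a^2-3b^2$, - $\alpha_{h_2i_2}=-\frac12(ac+bd)\Phi_1-\frac12(ad-bc)\Phi_2+4ab-2e$, - $\alpha_{h_2j}=\frac1{96}(M_2c-M_1d)r-\frac18Pbr+(\Phi_1c+\Phi_2d)s+2e(\Phi_2c-\Phi_1d)+8ae-4bs$. For $x\in\mathfrak g$ let $\widehat X:p\mapsto\omega_p^{-1}(x)$. Brackets of vector fields on $\mathcal P$ are computed component by component, $[V,W]^k=V(W^k)-W(V^k)$, with directional derivatives; a directional derivative that does not exist is counted as $0$ (this can only concern the $\partial_e$-component of a bracket with $\widehat T$, and does not occur for $\varphi\in\mathcal C^7$). Let $\omega_p$ be the inverse of $\omega_p^{-1}$, $\Omega(V,W)=V(\omega(W))-W(\omega(V))-\omega([V,W])+[\omega(V),\omega(W)]$ the curvature form, and $\kappa(p)$ the bilinear map on $\mathfrak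 g$ with $\kappa(p)(x,x')=\Omega_p(\widehat X,\widehat X')$ for $x,x'$ in the basis $\mathsf t,\dots,\mathsf j$. **Proposition.** 1. For every $p=(x,y,u,a,b,c,d,e)\in\mathcal P$ the map $\omega_p:T_p\mathcal P\to\mathfrak g$ is a linear isomorphism (with inverse $\omega_p^{-1}$), and the matrix of $\omega_p^{-1}$ with respect to the bases $\mathsf t,\dots,\mathsf j$ of $\mathfrak g$ and $T,H_1,H_2,D,R,I_1,I_2,J$ of $T_p\mathcal P$ has determinant $(c^2+d^2)^2\ne0$. 2. All coordinate components of $\widehat T,\dots,\widehat J$ are of class $\mathcal C^1$ on $\mathcal P$, except for the $\partial_e$-component of $\widehat T$, which is continuous, and of class $\mathcal C^1$ if $\varphi\in\mathcal C^7$. 3. $\omega$ is a Cartan connection: $\omega(D)=\mathsf d$, $\omega(R)=\mathsf r$, $\omega(I_1)=\mathsf i_1$, $\omega(I_2)=\mathsf i_2$, $\omega(J)=\mathsf j$, and it is (infinitesimally) equivariant: $[\widehat X,\widehat Y]=\widehat{[x,y]}$ for all $x\in\mathfrak h$, $y\in\mathfrak g$. 4. At every $p\in\mathcal P$, $\kappa(p)$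 is alternating, vanishes when one argument is in $\mathfrak h$, and has no component of homogeneity $h\le0$ (regularity). 5. $\omega$ is normal in Tanaka's sense: $\partial^*\big(\kappa(p)_{[h]}\big)=0$ for every $p\in\mathcal P$ and every $h\ge1$. -/

import Mathlib

namespace CartanTanaka

/-! ### The eight-dimensional graded Lie algebra `𝔤 = 𝔤₋₂ ⊕ 𝔤₋₁ ⊕ 𝔤₀ ⊕ 𝔤₁ ⊕ 𝔤₂` -/

/-- The real Lie algebra `𝔤` spanned by `t, h₁, h₂, d, r, i₁, i₂, j`, in this order: an element is
its list of eight coordinates. -/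
def Alg : Type := Fin 8 → ℝ

instance : AddCommGroup Alg := inferInstanceAs (AddCommGroup (Fin 8 → ℝ))
instance : Module ℝ Alg := inferInstanceAs (Module ℝ (Fin 8 → ℝ))

/-- The basis `t, h₁, h₂, d, r, i₁, i₂, j`. -/
noncomputable def algBasis : Module.Basis (Fin 8) ℝ Alg := Pi.basisFun ℝ (Fin 8)

@[ext] theorem Alg.ext {x y : Alg} (h : ∀ k : Fin 8, x k = y k) : x = y := funext h
@[simp] theorem Alg.add_apply (x y : Alg) (k : Fin 8) : (x + y) k = x k + y k := rfl
@[simp] theorem Alg.smul_apply (s : ℝ) (x : Alg) (k : Fin 8) : (s • x) k = s * x k := rfl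
@[simp] theorem Alg.zero_apply (k : Fin 8) : (0 : Alg) k = 0 := rfl
@[simp] theorem algBasis_apply (i k : Fin 8) : algBasis i k = if k = i then 1 else 0 := by
  have h : algBasis i = (Pi.single i (1 : ℝ) : Fin 8 → ℝ) := Pi.basisFun_apply ℝ (Fin 8) i
  rw [h, Pi.single_apply]

/-- The commutator table
`[t,d] = 2t`, `[t,i₁] = h₁`, `[t,i₂] = h₂`, `[t,j] = d`,
`[h₁,h₂] = 4t`, `[h₁,d] = h₁`, `[h₁,r] = h₂`, `[h₁,i₁] = 6r`, `[h₁,i₂] = 2d`, `[h₁,j] = i₁`,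
`[h₂,d] = h₂`, `[h₂,r] = -h₁`, `[h₂,i₁] = -2d`, `[h₂,i₂] = 6r`, `[h₂,j] = i₂`,
`[d,i₁] = i₁`, `[d,i₂] = i₂`, `[d,j] = 2j`, `[r,i₁] = -i₂`, `[r,i₂] = i₁`, `[i₁,i₂] = 4j`,
all other brackets of basis elements being zero. -/
def algBracket (x y : Alg) : Alg :=
  let w : Fin 8 → Fin 8 → ℝ := fun i j => x i * y j - x j * y i
  ![2 * w 0 3 + 4 * w 1 2,
    w 0 5 + w 1 3 - w 2 4,
    w 0 6 + w 1 4 + w 2 3,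
    w 0 7 + 2 * w 1 6 - 2 * w 2 5,
    6 * w 1 5 + 6 * w 2 6,
    w 1 7 + w 3 5 + w 4 6,
    w 2 7 + w 3 6 - w 4 5,
    2 * w 3 7 + 4 * w 5 6]

instance : Bracket Alg Alg := ⟨algBracket⟩

theorem lie_apply (x y : Alg) (k : Fin 8) : ⁅x, y⁆ k =
    (![2 * (x 0 * y 3 - x 3 * y 0) + 4 * (x 1 * y 2 - x 2 * y 1),
      (x 0 * y 5 - x 5 * y 0) + (x 1 * y 3 - x 3 * y 1) - (x 2 * y 4 - x 4 * y 2),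
      (x 0 * y 6 - x 6 * y 0) + (x 1 * y 4 - x 4 * y 1) + (x 2 * y 3 - x 3 * y 2),
      (x 0 * y 7 - x 7 * y 0) + 2 * (x 1 * y 6 - x 6 * y 1) - 2 * (x 2 * y 5 - x 5 * y 2),
      6 * (x 1 * y 5 - x 5 * y 1) + 6 * (x 2 * y 6 - x 6 * y 2),
      (x 1 * y 7 - x 7 * y 1) + (x 3 * y 5 - x 5 * y 3) + (x 4 * y 6 - x 6 * y 4),
      (x 2 * y 7 - x 7 * y 2) + (x 3 * y 6 - x 6 * y 3) - (x 4 * y 5 - x 5 * y 4),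
      2 * (x 3 * y 7 - x 7 * y 3) + 4 * (x 5 * y 6 - x 6 * y 5)] : Fin 8 → ℝ) k := rfl

instance : LieRing Alg where
  add_lie x y z := by
    ext k; fin_cases k <;> simp [lie_apply] <;> ring
  lie_add x y z := by
    ext k; fin_cases k <;> simp [lie_apply] <;> ring
  lie_self x := by
    ext k; fin_cases k <;> simp [lie_apply] <;> ring
  leibniz_lie x y z := by
    ext k; fin_cases k <;> simp [lie_apply] <;> ring

instance : LieAlgebra ℝ Alg where
  lie_smul s x y := by
    ext k; fin_cases k <;> simp [lie_apply] <;> ring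

/-- The degrees of `t, h₁, h₂, d, r, i₁, i₂, j`. -/
def deg : Fin 8 → ℤ := ![-2, -1, -1, 0, 0, 1, 1, 2]

/-- The projection of `𝔤` onto the span of the basis elements whose degree satisfies `s`. -/
def degProj (s : ℤ → Prop) [DecidablePred s] : Alg →ₗ[ℝ] Alg where
  toFun x := fun k => if s (deg k) then x k else 0
  map_add' x y := by
    funext k
    change (if s (deg k) then x k + y k else 0) =
      (if s (deg k) then x k else 0) + (if s (deg k) then y k else 0)
    split_ifs <;> simp
  map_smul' c x := by
    funext k
    change (if s (deg k) then c * x k else 0) = c * (if s (deg k) then x k else 0)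
    split_ifs <;> simp

/-- The projection `𝔤 → 𝔤ᵢ`. -/
def gradeProj (i : ℤ) : Alg →ₗ[ℝ] Alg := degProj (fun n => n = i)

/-- The projection `𝔤 → 𝔤₋ = 𝔤₋₂ ⊕ 𝔤₋₁` along `𝔥 = 𝔤₀ ⊕ 𝔤₁ ⊕ 𝔤₂`. -/
def projMinus : Alg →ₗ[ℝ] Alg := degProj (fun n => n < 0)

/-- The subspace `𝔤₋ = 𝔤₋₂ ⊕ 𝔤₋₁`. -/
def gMinus : Submodule ℝ Alg := Submodule.span ℝ {x | ∃ k, deg k < 0 ∧ x = algBasis k}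

/-- The isotropy subalgebra `𝔥 = 𝔤₀ ⊕ 𝔤₁ ⊕ 𝔤₂ = ℝd ⊕ ℝr ⊕ ℝi₁ ⊕ ℝi₂ ⊕ ℝj`. -/
def hSub : Submodule ℝ Alg := Submodule.span ℝ {x | ∃ k, 0 ≤ deg k ∧ x = algBasis k}

/-- The basis `t, h₁, h₂` of `𝔤₋`. -/
noncomputable def vMinus : Fin 3 → Alg := ![algBasis 0, algBasis 1, algBasis 2]

/-- The elements of `𝔤₊ = 𝔤₁ ⊕ 𝔤₂` that are dual to `t, h₁, h₂` for the Killing form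
(see `killingForm_vMinus_vDual`). -/
noncomputable def vDual : Fin 3 → Alg :=
  ![(-1 / 6 : ℝ) • algBasis 7, (-1 / 24 : ℝ) • algBasis 6, (1 / 24 : ℝ) • algBasis 5]

theorem killingForm_eq_sum (x y : Alg) :
    killingForm ℝ Alg x y = ∑ k, ⁅x, ⁅y, algBasis k⁆⁆ k := by
  rw [killingForm_apply_apply, LinearMap.trace_eq_matrix_trace ℝ algBasis, Matrix.trace]
  refine Finset.sum_congr rfl fun k _ => ?_
  rw [Matrix.diag_apply, LinearMap.toMatrix_apply]
  rfl

theorem killingForm_vMinus_vDual (i j : Fin 3) :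
    killingForm ℝ Alg (vMinus i) (vDual j) = if i = j then 1 else 0 := by
  rw [killingForm_eq_sum]
  fin_cases i <;> fin_cases j <;>
    simp [vMinus, vDual, lie_apply, Fin.sum_univ_eight] <;> norm_num

/-- `𝔤`-valued bilinear maps on `𝔤`; the alternating ones that vanish on `𝔥` are the elements of
`Λ²(𝔤/𝔥)* ⊗ 𝔤 ≅ 𝒞²(𝔤₋, 𝔤)`. -/
abbrev Cochain : Type := Alg →ₗ[ℝ] Alg →ₗ[ℝ] Alg

/-- The component `Ψ_[h]` of homogeneity `h` of a `2`-cochain on `𝔤₋`: for `x ∈ 𝔤ᵢ`, `y ∈ 𝔤ⱼ` with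
`i, j < 0`, `Ψ_[h](x, y)` is the `𝔤_{i+j+h}`-component of `Ψ(x, y)`. -/
def homog (Ψ : Cochain) (h : ℤ) : Cochain :=
  ∑ i ∈ ({-2, -1} : Finset ℤ), ∑ j ∈ ({-2, -1} : Finset ℤ),
    (Ψ.compl₁₂ (gradeProj i) (gradeProj j)).compr₂ (gradeProj (i + j + h))

/-- The codifferential `∂* : 𝒞²(𝔤₋, 𝔤) → 𝒞¹(𝔤₋, 𝔤)`,
`(∂*Ψ)(z) = ∑ᵢ [vᵢ*, Ψ(vᵢ, z)] + ½ ∑ᵢ Ψ(proj_{𝔤₋}[vᵢ*, z], vᵢ)`. -/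
noncomputable def codiff (Ψ : Cochain) (z : Alg) : Alg :=
  ∑ i, ⁅vDual i, Ψ (vMinus i) z⁆ +
    (1 / 2 : ℝ) • ∑ i, Ψ (projMinus ⁅vDual i, z⁆) (vMinus i)

/-! ### The hypersurface `v = φ(x, y, u)`, with intrinsic coordinates `(x, y, u)` -/

abbrev Base : Type := Fin 3 → ℝ

/-- The partial derivative of `f` with respect to the `i`-th of the coordinates `x, y, u`. -/
noncomputable def pd (i : Fin 3) (f : Base → ℝ) (q : Base) : ℝ := fderiv ℝ f q (Pi.single i 1)

/-- `H₁ = ∂ₓ + (φ_y - φ_x φ_u)/(1 + φ_u²) ∂ᵤ`. -/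
noncomputable def H1 (φ : Base → ℝ) (q : Base) : Base :=
  ![1, 0, (pd 1 φ q - pd 0 φ q * pd 2 φ q) / (1 + pd 2 φ q ^ 2)]

/-- `H₂ = ∂_y + (-φ_x - φ_y φ_u)/(1 + φ_u²) ∂ᵤ`. -/
noncomputable def H2 (φ : Base → ℝ) (q : Base) : Base :=
  ![0, 1, (-pd 0 φ q - pd 1 φ q * pd 2 φ q) / (1 + pd 2 φ q ^ 2)]

/-- `T = ¼ [H₁, H₂]`, a multiple of `∂ᵤ`. -/
noncomputable def T (φ : Base → ℝ) (q : Base) : Base :=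
  (1 / 4 : ℝ) • VectorField.lieBracket ℝ (H1 φ) (H2 φ) q

/-- Levi nondegeneracy: the complex tangent fields `H₁, H₂` and their bracket span the tangent
space. -/
def LeviNondegenerateAt (φ : Base → ℝ) (q : Base) : Prop :=
  LinearIndependent ℝ ![H1 φ q, H2 φ q, VectorField.lieBracket ℝ (H1 φ) (H2 φ) q]

/-- `Φ₁`, the function with `[H₁, T] = Φ₁ T` (both sides are multiples of `∂ᵤ`). -/
noncomputable def Phi1 (φ : Base → ℝ) (q : Base) : ℝ :=
  VectorField.lieBracket ℝ (H1 φ) (T φ) q 2 / T φ q 2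

/-- `Φ₂`, the function with `[H₂, T] = Φ₂ T` (both sides are multiples of `∂ᵤ`). -/
noncomputable def Phi2 (φ : Base → ℝ) (q : Base) : ℝ :=
  VectorField.lieBracket ℝ (H2 φ) (T φ) q 2 / T φ q 2

/-- The derivative `H₁(f)`. -/
noncomputable def D1 (φ f : Base → ℝ) (q : Base) : ℝ := fderiv ℝ f q (H1 φ q)

/-- The derivative `H₂(f)`. -/
noncomputable def D2 (φ f : Base → ℝ) (q : Base) : ℝ := fderiv ℝ f q (H2 φ q)

/-! ### The bundle `𝒫`, with coordinates `(x, y, u, a, b, c, d, e)`, and the frame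
`T, H₁, H₂, D, R, I₁, I₂, J` -/

abbrev Tot : Type := Fin 8 → ℝ

/-- The projection `(x, y, u, a, b, c, d, e) ↦ (x, y, u)`. -/
def base (p : Tot) : Base := ![p 0, p 1, p 2]

/-- The bundle over `U`: the fibre is `{(a, b, c, d, e) : c² + d² ≠ 0}`. -/
def bundle (U : Set Base) : Set Tot := {p | base p ∈ U ∧ p 5 ^ 2 + p 6 ^ 2 ≠ 0}

/-- The horizontal tangent vector of `𝒫` with the same components as `v`. -/
def horiz (v : Base) : Tot := ![v 0, v 1, v 2, 0, 0, 0, 0, 0]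

/-- The frame `T, H₁, H₂, D, R, I₁, I₂, J` of `T𝒫`; the last five are left-invariant fields on the
structure group:
`D = -a ∂ₐ - b ∂_b - c ∂_c - d ∂_d - 2e ∂ₑ`, `R = -b ∂ₐ + a ∂_b + d ∂_c - c ∂_d`,
`I₁ = ∂ₐ - b ∂ₑ`, `I₂ = ∂_b + a ∂ₑ`, `J = ½ ∂ₑ`. -/
noncomputable def frame (φ : Base → ℝ) (p : Tot) : Fin 8 → Tot :=
  ![horiz (T φ (base p)),
    horiz (H1 φ (base p)),
    horiz (H2 φ (base p)),
    ![0, 0, 0, -p 3, -p 4, -p 5, -p 6, -2 * p 7],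
    ![0, 0, 0, -p 4, p 3, p 6, -p 5, 0],
    ![0, 0, 0, 1, 0, 0, 0, -p 4],
    ![0, 0, 0, 0, 1, 0, 0, p 3],
    ![0, 0, 0, 0, 0, 0, 0, 1 / 2]]

/-! ### The coefficients `α` of the Cartan connection -/

/-- The combination `H₁(Φ₁) + H₂(Φ₂)`. -/
noncomputable def cP (φ : Base → ℝ) (q : Base) : ℝ :=
  D1 φ (Phi1 φ) q + D2 φ (Phi2 φ) q

/-- `Φ₁H₁(Φ₁) + Φ₁H₂(Φ₂) - H₁(H₁(Φ₁)) - 5H₁(H₂(Φ₂)) + 4H₂(H₁(Φ₂))`. -/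
noncomputable def cK1 (φ : Base → ℝ) (q : Base) : ℝ :=
  Phi1 φ q * D1 φ (Phi1 φ) q + Phi1 φ q * D2 φ (Phi2 φ) q
    - D1 φ (D1 φ (Phi1 φ)) q - 5 * D1 φ (D2 φ (Phi2 φ)) q + 4 * D2 φ (D1 φ (Phi2 φ)) q

/-- `Φ₂H₁(Φ₁) + Φ₂H₂(Φ₂) - H₂(H₂(Φ₂)) - 5H₂(H₁(Φ₁)) + 4H₁(H₁(Φ₂))`. -/
noncomputable def cK2 (φ : Base → ℝ) (q : Base) : ℝ :=
  Phi2 φ q * D1 φ (Phi1 φ) q + Phi2 φ q * D2 φ (Phi2 φ) q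
    - D2 φ (D2 φ (Phi2 φ)) q - 5 * D2 φ (D1 φ (Phi1 φ)) q + 4 * D1 φ (D1 φ (Phi2 φ)) q

/-- `Φ₂H₁(Φ₁) + Φ₂H₂(Φ₂) - H₂(H₂(Φ₂)) + 7H₂(H₁(Φ₁)) - 8H₁(H₁(Φ₂))`. -/
noncomputable def cM1 (φ : Base → ℝ) (q : Base) : ℝ :=
  Phi2 φ q * D1 φ (Phi1 φ) q + Phi2 φ q * D2 φ (Phi2 φ) q
    - D2 φ (D2 φ (Phi2 φ)) q + 7 * D2 φ (D1 φ (Phi1 φ)) q - 8 * D1 φ (D1 φ (Phi2 φ)) q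

/-- `-Φ₁H₁(Φ₁) - Φ₁H₂(Φ₂) + H₁(H₁(Φ₁)) - 7H₁(H₂(Φ₂)) + 8H₂(H₁(Φ₂))`. -/
noncomputable def cM2 (φ : Base → ℝ) (q : Base) : ℝ :=
  -(Phi1 φ q * D1 φ (Phi1 φ) q) - Phi1 φ q * D2 φ (Phi2 φ) q
    + D1 φ (D1 φ (Phi1 φ)) q - 7 * D1 φ (D2 φ (Phi2 φ)) q + 8 * D2 φ (D1 φ (Phi2 φ)) q

/-- `Φ₁H₁(Φ₁) + Φ₁H₂(Φ₂) - H₁(H₁(Φ₁)) - H₁(H₂(Φ₂))`. -/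
noncomputable def cN1 (φ : Base → ℝ) (q : Base) : ℝ :=
  Phi1 φ q * D1 φ (Phi1 φ) q + Phi1 φ q * D2 φ (Phi2 φ) q
    - D1 φ (D1 φ (Phi1 φ)) q - D1 φ (D2 φ (Phi2 φ)) q

/-- `-Φ₂H₁(Φ₁) - Φ₂H₂(Φ₂) + H₂(H₁(Φ₁)) + H₂(H₂(Φ₂))`. -/
noncomputable def cN2 (φ : Base → ℝ) (q : Base) : ℝ :=
  -(Phi2 φ q * D1 φ (Phi1 φ) q) - Phi2 φ q * D2 φ (Phi2 φ) q
    + D2 φ (D1 φ (Phi1 φ)) q + D2 φ (D2 φ (Phi2 φ)) q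

/-- The coefficient of `(c² + d²)²` in `α_{tj}`. -/
noncomputable def cQ (φ : Base → ℝ) (q : Base) : ℝ :=
  1 / 384 * D1 φ (D1 φ (D1 φ (Phi1 φ))) q + 1 / 384 * D2 φ (D2 φ (D2 φ (Phi2 φ))) q
    - 7 / 384 * D1 φ (D1 φ (D2 φ (Phi2 φ))) q - 7 / 384 * D2 φ (D2 φ (D1 φ (Phi1 φ))) q
    + 1 / 48 * D1 φ (D2 φ (D1 φ (Phi2 φ))) q + 1 / 48 * D2 φ (D1 φ (D1 φ (Phi2 φ))) q
    - 1 / 192 * (Phi1 φ q * D1 φ (D1 φ (Phi1 φ)) q) - 1 / 192 * (Phi2 φ q * D2 φ (D2 φ (Phi2 φ)) q)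
    + 1 / 64 * (Phi1 φ q * D1 φ (D2 φ (Phi2 φ)) q) + 1 / 64 * (Phi2 φ q * D2 φ (D1 φ (Phi1 φ)) q)
    - 1 / 48 * (Phi1 φ q * D2 φ (D1 φ (Phi2 φ)) q) - 1 / 48 * (Phi2 φ q * D1 φ (D1 φ (Phi2 φ)) q)
    + 1 / 384 * (Phi1 φ q ^ 2 + Phi2 φ q ^ 2) * (D1 φ (Phi1 φ) q + D2 φ (Phi2 φ) q)
    - 11 / 3072 * D1 φ (Phi1 φ) q ^ 2 - 11 / 3072 * D2 φ (Phi2 φ) q ^ 2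
    - 11 / 1536 * (D1 φ (Phi1 φ) q * D2 φ (Phi2 φ) q)

/-- The matrix `α`: its rows are the coefficients of the constant fields
`T̂, Ĥ₁, Ĥ₂, D̂, R̂, Î₁, Î₂, Ĵ` in the frame `T, H₁, H₂, D, R, I₁, I₂, J`. -/
noncomputable def alpha (φ : Base → ℝ) (p : Tot) : Matrix (Fin 8) (Fin 8) ℝ :=
  let q := base p
  let a := p 3
  let b := p 4
  let c := p 5
  let d := p 6
  let e := p 7
  let F1 := Phi1 φ q
  let F2 := Phi2 φ q
  let P := cP φ q
  let r := c ^ 2 + d ^ 2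
  let s := a ^ 2 + b ^ 2
  let td := 1 / 2 * (b * d - a * c) * F1 - 1 / 2 * (b * c + a * d) * F2 - 2 * e
  let tr := 1 / 32 * P * r - 1 / 2 * (a * d + b * c) * F1 + 1 / 2 * (a * c - b * d) * F2
    + 3 * a ^ 2 + 3 * b ^ 2
  let ti1 := 1 / 192 * (cK1 φ q * c + cK2 φ q * d) * r + 1 / 16 * P * b * r
    - 1 / 2 * (F1 * c + F2 * d) * s + 2 * b * s
  let ti2 := 1 / 192 * (cK2 φ q * c - cK1 φ q * d) * r - 1 / 16 * P * a * r
    - 1 / 2 * (F2 * c - F1 * d) * s - 2 * a * s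
  let tj := cQ φ q * r ^ 2
    + 1 / 32 * (cN2 φ q * (a * c - b * d) + cN1 φ q * (a * d + b * c)) * r
    + 3 / 16 * P * s * r
    + (F2 * (a * c - b * d) - F1 * (a * d + b * c)) * s
    - 2 * e * (F1 * (a * c - b * d) + F2 * (a * d + b * c))
    + 3 * s ^ 2 - 4 * e ^ 2
  let h1d := -2 * b + 1 / 2 * F1 * c + 1 / 2 * F2 * d
  let h1r := -6 * a - 1 / 2 * F2 * c + 1 / 2 * F1 * d
  let h1i1 := 1 / 2 * (b * d + a * c) * F1 - 1 / 2 * (b * c - a * d) * F2 - 4 * a * b - 2 * e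
  let h1i2 := 1 / 32 * P * r + 1 / 2 * (b * c - a * d) * F1 + 1 / 2 * (a * c + b * d) * F2
    + 3 * a ^ 2 - b ^ 2
  let h1j := 1 / 96 * (cM1 φ q * c + cM2 φ q * d) * r - 1 / 8 * P * a * r
    - (F2 * c - F1 * d) * s + 2 * e * (F1 * c + F2 * d) - 8 * b * e - 4 * a * s
  let h2d := 2 * a + 1 / 2 * F2 * c - 1 / 2 * F1 * d
  let h2r := -6 * b + 1 / 2 * F1 * c + 1 / 2 * F2 * d
  let h2i1 := -(1 / 32) * P * r + 1 / 2 * (b * c - a * d) * F1 + 1 / 2 * (a * c + b * d) * F2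
    + a ^ 2 - 3 * b ^ 2
  let h2i2 := -(1 / 2) * (a * c + b * d) * F1 - 1 / 2 * (a * d - b * c) * F2 + 4 * a * b - 2 * e
  let h2j := 1 / 96 * (cM2 φ q * c - cM1 φ q * d) * r - 1 / 8 * P * b * r
    + (F1 * c + F2 * d) * s + 2 * e * (F2 * c - F1 * d) + 8 * a * e - 4 * b * s
  !![r, b * d - a * c, -(a * d) - b * c, td, tr, ti1, ti2, tj;
     0, c, d, h1d, h1r, h1i1, h1i2, h1j;
     0, -d, c, h2d, h2r, h2i1, h2i2, h2j;
     0, 0, 0, 1, 0, 0, 0, 0;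
     0, 0, 0, 0, 1, 0, 0, 0;
     0, 0, 0, 0, 0, 1, 0, 0;
     0, 0, 0, 0, 0, 0, 1, 0;
     0, 0, 0, 0, 0, 0, 0, 1]

/-! ### The Cartan connection and its curvature -/

/-- The matrix whose rows are the coordinate vectors of `T̂, Ĥ₁, Ĥ₂, D̂, R̂, Î₁, Î₂, Ĵ` at `p`. -/
noncomputable def hatMatrix (φ : Base → ℝ) (p : Tot) : Matrix (Fin 8) (Fin 8) ℝ :=
  alpha φ p * Matrix.of (frame φ p)

/-- `ω_p⁻¹ : 𝔤 → T_p𝒫`, which sends `t, …, j` to `T̂, …, Ĵ`. -/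
noncomputable def omegaInv (φ : Base → ℝ) (p : Tot) : Alg →ₗ[ℝ] Tot :=
  (hatMatrix φ p).vecMulLinear

/-- The Cartan connection `ω_p : T_p𝒫 → 𝔤`: the coordinates of a tangent vector in the frame
`T̂, Ĥ₁, Ĥ₂, D̂, R̂, Î₁, Î₂, Ĵ`. -/
noncomputable def omega (φ : Base → ℝ) (p : Tot) : Tot →ₗ[ℝ] Alg :=
  (hatMatrix φ p)⁻¹.vecMulLinear

/-- The constant vector field `X̂ = ω⁻¹(x)`. -/
noncomputable def hat (φ : Base → ℝ) (x : Alg) : Tot → Tot := fun p => omegaInv φ p x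

/-- The derivative `V(f)` of a function along a vector field. -/
noncomputable def along (V : Tot → Tot) (f : Tot → ℝ) (p : Tot) : ℝ := lineDeriv ℝ f p (V p)

/-- The Lie bracket of vector fields on `𝒫`, `[V, W]ᵏ = V(Wᵏ) - W(Vᵏ)`, computed component by
component with directional derivatives, so that a component of the bracket only uses the
derivatives of that component of the fields. -/
noncomputable def lieBr (V W : Tot → Tot) (p : Tot) : Tot :=
  fun k => along V (fun q => W q k) p - along W (fun q => V q k) p

/-- For differentiable vector fields this is Mathlib's Lie bracket. -/
theorem lieBr_eq_lieBracket {V W : Tot → Tot} {p : Tot}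
    (hV : DifferentiableAt ℝ V p) (hW : DifferentiableAt ℝ W p) :
    lieBr V W p = VectorField.lieBracket ℝ V W p := by
  funext k
  have hVk : DifferentiableAt ℝ (fun q => V q k) p := differentiableAt_pi.1 hV k
  have hWk : DifferentiableAt ℝ (fun q => W q k) p := differentiableAt_pi.1 hW k
  simp only [lieBr, along, hVk.lineDeriv_eq_fderiv, hWk.lineDeriv_eq_fderiv,
    VectorField.lieBracket, Pi.sub_apply, fderiv_apply hV, fderiv_apply hW]
  rfl

/-- `dω(V, W) = V(ω(W)) - W(ω(V)) - ω([V, W])`. -/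
noncomputable def dOmega (φ : Base → ℝ) (V W : Tot → Tot) (p : Tot) : Alg :=
  let u : Alg := fun k =>
    along V (fun q => omega φ q (W q) k) p - along W (fun q => omega φ q (V q) k) p
  u - omega φ p (lieBr V W p)

/-- The curvature form `Ω(V, W) = dω(V, W) + [ω(V), ω(W)]`. -/
noncomputable def curvForm (φ : Base → ℝ) (V W : Tot → Tot) (p : Tot) : Alg :=
  dOmega φ V W p + ⁅omega φ p (V p), omega φ p (W p)⁆

/-- The curvature function `κ(p)`: the bilinear map that sends a pair `(x, x')` of elements of the
basis `t, …, j` to `Ω_p(X̂, X̂')`. -/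
noncomputable def kappa (φ : Base → ℝ) (p : Tot) : Cochain :=
  algBasis.constr ℝ fun i => algBasis.constr ℝ fun j =>
    curvForm φ (hat φ (algBasis i)) (hat φ (algBasis j)) p

/-- Tanaka normality over `U`: the codifferential annihilates every homogeneous component of
positive degree of the curvature function. -/
def IsNormal (φ : Base → ℝ) (U : Set Base) : Prop :=
  ∀ p ∈ bundle U, ∀ h : ℤ, 1 ≤ h → ∀ z ∈ gMinus, codiff (homog (kappa φ p) h) z = 0

end CartanTanaka

namespace CartanTanaka

open VectorField Filter Topology

variable {φ : Base → ℝ} {U : Set Base} {q : Base} {p : Tot}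

/-! ### Regularity of the fields on the base -/

/-! The constant fields are combinations of the frame `T, H₁, H₂, D, R, I₁, I₂, J` whose
coefficients are polynomials in the fibre coordinates and in ten functions on the base. Everything
therefore reduces to brackets of such combinations. By the Leibniz rule (`lieBr_comb`) these follow
from `[H₁, H₂] = 4T`, `[Hᵢ, T] = Φᵢ T` and the brackets of `𝔥` for the vertical fields.

Vertical directions: the base functions are constant along the fibres, so `[X̂, Ŷ] = hat [x, y]` is
a polynomial identity in fifteen variables, subject only to two linear relations that express `N₁,
N₂` through the `Kᵢ` and `Mᵢ` (`vecMul_dAlphaOf_add_frameLie`). Consequently the curvature vanishes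
as soon as one argument lies in `𝔥`.

Horizontal directions: differential identities for `Φ₁, Φ₂` are needed as well, namely `H₁Φ₂ =
H₂Φ₁`, which is the Jacobi identity (`D1_Phi2`), and `[Hᵢ, [H₁, H₂]] = Φᵢ [H₁, H₂]` applied to `Φ₁`
and `Φ₂` (`third_order_relations`). Modulo these, `bracketCoeff_horizontal` yields `[Ĥ₁, Ĥ₂] = 4T̂`.
It also shows that `[T̂, Ĥᵢ]` has only `I₁, I₂, J` components, and that the `I₁`-component of `[T̂,
Ĥ₁]` and the `I₂`-component of `[T̂, Ĥ₂]` add up to zero. So `κ` lives on the pairs `(t, h₁), (t,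
h₂)` with values in `𝔤₁ ⊕ 𝔤₂`, that is, in homogeneities 4 and 5, which gives regularity. For degree
reasons the only part of `∂*κ` that could survive is the `j`-component of its value at `t`, a
multiple of the sum just mentioned, and normality follows (`codiff_eq_zero`).

The function `Q` is of order three in the `Φᵢ`, hence of order six in `φ`, and may be merely
continuous. It occurs in `α_{tj}` alone, and no horizontal derivative of it is ever needed: `[Ĥ₁,
Ĥ₂]` does not differentiate `α_{tj}`, the vertical derivatives of `Q` vanish, and in `[T̂, Ĥᵢ]` such
a derivative affects only the `J`-component, on which normality imposes no condition. -/

theorem contDiffOn_fderiv_apply {n m : WithTop ℕ∞} {f : Base → ℝ} {V : Base → Base}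
    (hU : IsOpen U) (hf : ContDiffOn ℝ m f U) (hV : ContDiffOn ℝ n V U) (h : n + 1 ≤ m) :
    ContDiffOn ℝ n (fun q => fderiv ℝ f q (V q)) U :=
  (hf.fderiv_of_isOpen hU h).clm_apply hV

theorem contDiffOn_pd {n m : WithTop ℕ∞} {f : Base → ℝ} (hU : IsOpen U)
    (hf : ContDiffOn ℝ m f U) (h : n + 1 ≤ m) (i : Fin 3) : ContDiffOn ℝ n (pd i f) U :=
  contDiffOn_fderiv_apply hU hf contDiffOn_const h

theorem contDiffOn_H1 {n m : WithTop ℕ∞} (hU : IsOpen U) (hφ : ContDiffOn ℝ m φ U)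
    (h : n + 1 ≤ m) : ContDiffOn ℝ n (H1 φ) U := by
  have hp := contDiffOn_pd hU hφ h
  refine contDiffOn_pi.2 fun i => ?_
  fin_cases i
  · exact contDiffOn_const
  · exact contDiffOn_const
  · exact ((hp 1).sub ((hp 0).mul (hp 2))).div (contDiffOn_const.add ((hp 2).pow 2))
      fun x _ => by positivity

theorem contDiffOn_H2 {n m : WithTop ℕ∞} (hU : IsOpen U) (hφ : ContDiffOn ℝ m φ U)
    (h : n + 1 ≤ m) : ContDiffOn ℝ n (H2 φ) U := by
  have hp := contDiffOn_pd hU hφ h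
  refine contDiffOn_pi.2 fun i => ?_
  fin_cases i
  · exact contDiffOn_const
  · exact contDiffOn_const
  · exact ((hp 0).neg.sub ((hp 1).mul (hp 2))).div (contDiffOn_const.add ((hp 2).pow 2))
      fun x _ => by positivity

theorem contDiffOn_lieBracket {n m : WithTop ℕ∞} {V W : Base → Base} (hU : IsOpen U)
    (hV : ContDiffOn ℝ m V U) (hW : ContDiffOn ℝ m W U) (h : n + 1 ≤ m) :
    ContDiffOn ℝ n (lieBracket ℝ V W) U := fun q hq =>
  ((hV.contDiffAt (hU.mem_nhds hq)).lieBracket_vectorField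
    (hW.contDiffAt (hU.mem_nhds hq)) h).contDiffWithinAt

theorem contDiffOn_T {n m : WithTop ℕ∞} (hU : IsOpen U) (hφ : ContDiffOn ℝ m φ U)
    (h : n + 1 + 1 ≤ m) : ContDiffOn ℝ n (T φ) U :=
  (contDiffOn_lieBracket hU (contDiffOn_H1 hU hφ h) (contDiffOn_H2 hU hφ h) le_rfl).const_smul _

/-- A component that is constant along both fields does not occur in their bracket. -/
theorem lieBracket_apply_eq_zero {V W : Base → Base} {k : Fin 3} {v w : ℝ}
    (hV : DifferentiableAt ℝ V q) (hW : DifferentiableAt ℝ W q)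
    (hv : ∀ᶠ x in 𝓝 q, V x k = v) (hw : ∀ᶠ x in 𝓝 q, W x k = w) : lieBracket ℝ V W q k = 0 := by
  have key : ∀ {Z : Base → Base} {z : ℝ}, DifferentiableAt ℝ Z q → (∀ᶠ x in 𝓝 q, Z x k = z) →
      ∀ y, fderiv ℝ Z q y k = 0 := by
    intro Z z hZ hz y
    have h1 := fderiv_apply hZ k
    have h2 : fderiv ℝ (fun x => Z x k) q = 0 := by
      rw [EventuallyEq.fderiv_eq (f := fun _ => z) hz, fderiv_fun_const]; rfl
    rw [h2] at h1
    simpa using (DFunLike.congr_fun h1 y).symm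
  simp [lieBracket, key hV hv, key hW hw]

/-- A Levi nondegenerate hypersurface `v = φ(x, y, u)` of class `𝒞⁶` over the open set `U`. -/
structure IsLeviHypersurface (φ : Base → ℝ) (U : Set Base) : Prop where
  isOpen : IsOpen U
  contDiffOn : ContDiffOn ℝ 6 φ U
  levi : ∀ q ∈ U, LeviNondegenerateAt φ q

theorem IsLeviHypersurface.differentiableAt_H1
    (h : IsLeviHypersurface φ U) (hq : q ∈ U) : DifferentiableAt ℝ (H1 φ) q :=
  ((contDiffOn_H1 (n := 5) h.isOpen h.contDiffOn (by norm_num)).contDiffAt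
    (h.isOpen.mem_nhds hq)).differentiableAt (by norm_num)

theorem IsLeviHypersurface.differentiableAt_H2
    (h : IsLeviHypersurface φ U) (hq : q ∈ U) : DifferentiableAt ℝ (H2 φ) q :=
  ((contDiffOn_H2 (n := 5) h.isOpen h.contDiffOn (by norm_num)).contDiffAt
    (h.isOpen.mem_nhds hq)).differentiableAt (by norm_num)

theorem IsLeviHypersurface.differentiableAt_T
    (h : IsLeviHypersurface φ U) (hq : q ∈ U) : DifferentiableAt ℝ (T φ) q :=
  ((contDiffOn_T (n := 4) h.isOpen h.contDiffOn (by norm_num)).contDiffAt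
    (h.isOpen.mem_nhds hq)).differentiableAt (by norm_num)

theorem IsLeviHypersurface.T_apply_zero
    (h : IsLeviHypersurface φ U) (hq : q ∈ U) : T φ q 0 = 0 := by
  have h0 := lieBracket_apply_eq_zero (k := 0) (v := 1) (w := 0) (h.differentiableAt_H1 hq)
    (h.differentiableAt_H2 hq) (Eventually.of_forall fun _ => rfl)
    (Eventually.of_forall fun _ => rfl)
  simp [T, h0]

theorem IsLeviHypersurface.T_apply_one
    (h : IsLeviHypersurface φ U) (hq : q ∈ U) : T φ q 1 = 0 := by
  have h0 := lieBracket_apply_eq_zero (k := 1) (v := 0) (w := 1) (h.differentiableAt_H1 hq)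
    (h.differentiableAt_H2 hq) (Eventually.of_forall fun _ => rfl)
    (Eventually.of_forall fun _ => rfl)
  simp [T, h0]

theorem lieBracket_H1_H2 : lieBracket ℝ (H1 φ) (H2 φ) q = (4 : ℝ) • T φ q := by
  rw [T, smul_smul]; norm_num

/-- Levi nondegeneracy enters the whole argument through this: it permits division by the
`∂ᵤ`-component of `T`, so that `Φ₁, Φ₂` are smooth enough and the frame is a basis. -/
theorem IsLeviHypersurface.T_apply_two_ne_zero
    (h : IsLeviHypersurface φ U) (hq : q ∈ U) : T φ q 2 ≠ 0 := by
  intro h2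
  have hT : T φ q = 0 := by
    ext i; fin_cases i
    · exact h.T_apply_zero hq
    · exact h.T_apply_one hq
    · exact h2
  refine (h.levi q hq).ne_zero 2 ?_
  change lieBracket ℝ (H1 φ) (H2 φ) q = 0
  rw [lieBracket_H1_H2, hT, smul_zero]

theorem IsLeviHypersurface.lieBracket_H1_T
    (h : IsLeviHypersurface φ U) (hq : q ∈ U) : lieBracket ℝ (H1 φ) (T φ) q = Phi1 φ q • T φ q := by
  have hT0 : ∀ᶠ x in 𝓝 q, T φ x 0 = 0 :=
    eventually_of_mem (h.isOpen.mem_nhds hq) fun x hx => h.T_apply_zero hx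
  have hT1 : ∀ᶠ x in 𝓝 q, T φ x 1 = 0 :=
    eventually_of_mem (h.isOpen.mem_nhds hq) fun x hx => h.T_apply_one hx
  have hH := h.differentiableAt_H1 hq
  have hT := h.differentiableAt_T hq
  ext i; fin_cases i
  · have := lieBracket_apply_eq_zero (k := 0) (v := 1) hH hT (Eventually.of_forall fun _ => rfl) hT0
    simpa [h.T_apply_zero hq] using this
  · have := lieBracket_apply_eq_zero (k := 1) (v := 0) hH hT (Eventually.of_forall fun _ => rfl) hT1
    simpa [h.T_apply_one hq] using this
  · exact (div_mul_cancel₀ _ (h.T_apply_two_ne_zero hq)).symm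

theorem IsLeviHypersurface.lieBracket_H2_T
    (h : IsLeviHypersurface φ U) (hq : q ∈ U) : lieBracket ℝ (H2 φ) (T φ) q = Phi2 φ q • T φ q := by
  have hT0 : ∀ᶠ x in 𝓝 q, T φ x 0 = 0 :=
    eventually_of_mem (h.isOpen.mem_nhds hq) fun x hx => h.T_apply_zero hx
  have hT1 : ∀ᶠ x in 𝓝 q, T φ x 1 = 0 :=
    eventually_of_mem (h.isOpen.mem_nhds hq) fun x hx => h.T_apply_one hx
  have hH := h.differentiableAt_H2 hq
  have hT := h.differentiableAt_T hq
  ext i; fin_cases i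
  · have := lieBracket_apply_eq_zero (k := 0) (v := 0) hH hT (Eventually.of_forall fun _ => rfl) hT0
    simpa [h.T_apply_zero hq] using this
  · have := lieBracket_apply_eq_zero (k := 1) (v := 1) hH hT (Eventually.of_forall fun _ => rfl) hT1
    simpa [h.T_apply_one hq] using this
  · exact (div_mul_cancel₀ _ (h.T_apply_two_ne_zero hq)).symm

theorem IsLeviHypersurface.contDiffOn_Phi1 {n m : WithTop ℕ∞}
    (h : IsLeviHypersurface φ U) (hφ : ContDiffOn ℝ m φ U) (hn : n + 1 + 1 + 1 ≤ m) :
    ContDiffOn ℝ n (Phi1 φ) U := by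
  have hT := contDiffOn_T h.isOpen hφ hn
  have hH := (contDiffOn_H1 h.isOpen hφ hn).of_le (le_self_add : n + 1 ≤ n + 1 + 1)
  exact (contDiffOn_pi.1 (contDiffOn_lieBracket h.isOpen hH hT le_rfl) 2).div
    ((contDiffOn_pi.1 hT 2).of_le le_self_add) fun x hx => h.T_apply_two_ne_zero hx

theorem IsLeviHypersurface.contDiffOn_Phi2 {n m : WithTop ℕ∞}
    (h : IsLeviHypersurface φ U) (hφ : ContDiffOn ℝ m φ U) (hn : n + 1 + 1 + 1 ≤ m) :
    ContDiffOn ℝ n (Phi2 φ) U := by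
  have hT := contDiffOn_T h.isOpen hφ hn
  have hH := (contDiffOn_H2 h.isOpen hφ hn).of_le (le_self_add : n + 1 ≤ n + 1 + 1)
  exact (contDiffOn_pi.1 (contDiffOn_lieBracket h.isOpen hH hT le_rfl) 2).div
    ((contDiffOn_pi.1 hT 2).of_le le_self_add) fun x hx => h.T_apply_two_ne_zero hx

/-! ### Commutation relations between derivatives along `T, H₁, H₂` -/

/-- The derivative `T(f)`. -/
noncomputable def DT (φ f : Base → ℝ) (q : Base) : ℝ := fderiv ℝ f q (T φ q)

theorem IsLeviHypersurface.contDiffOn_D1 {n m : WithTop ℕ∞} {k : ℕ} {f : Base → ℝ}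
    (h : IsLeviHypersurface φ U) (hφ : ContDiffOn ℝ k φ U) (hf : ContDiffOn ℝ m f U)
    (hn : n + 1 ≤ m) (hk : n + 1 ≤ k) : ContDiffOn ℝ n (D1 φ f) U :=
  contDiffOn_fderiv_apply h.isOpen hf (contDiffOn_H1 h.isOpen hφ hk) hn

theorem IsLeviHypersurface.contDiffOn_D2 {n m : WithTop ℕ∞} {k : ℕ} {f : Base → ℝ}
    (h : IsLeviHypersurface φ U) (hφ : ContDiffOn ℝ k φ U) (hf : ContDiffOn ℝ m f U)
    (hn : n + 1 ≤ m) (hk : n + 1 ≤ k) : ContDiffOn ℝ n (D2 φ f) U :=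
  contDiffOn_fderiv_apply h.isOpen hf (contDiffOn_H2 h.isOpen hφ hk) hn

theorem IsLeviHypersurface.D1_congr {f g : Base → ℝ} (h : IsLeviHypersurface φ U)
    (hfg : ∀ x ∈ U, f x = g x) (hq : q ∈ U) : D1 φ f q = D1 φ g q := by
  rw [D1, D1, EventuallyEq.fderiv_eq (eventually_of_mem (h.isOpen.mem_nhds hq) hfg)]

theorem IsLeviHypersurface.D2_congr {f g : Base → ℝ} (h : IsLeviHypersurface φ U)
    (hfg : ∀ x ∈ U, f x = g x) (hq : q ∈ U) : D2 φ f q = D2 φ g q := by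
  rw [D2, D2, EventuallyEq.fderiv_eq (eventually_of_mem (h.isOpen.mem_nhds hq) hfg)]

/-- `4 T(f) = H₁H₂(f) - H₂H₁(f)`. -/
theorem IsLeviHypersurface.DT_eq {f : Base → ℝ} (h : IsLeviHypersurface φ U)
    (hf : ContDiffOn ℝ 2 f U) (hq : q ∈ U) :
    DT φ f q = (1 / 4) * (D1 φ (D2 φ f) q - D2 φ (D1 φ f) q) := by
  have key := fderiv_apply_lieBracket (hf.contDiffAt (h.isOpen.mem_nhds hq)) (by simp)
    (h.differentiableAt_H2 hq) (h.differentiableAt_H1 hq)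
  rw [lieBracket_H1_H2, map_smul] at key
  change (4 : ℝ) • DT φ f q = D1 φ (D2 φ f) q - D2 φ (D1 φ f) q at key
  rw [← key, smul_eq_mul]; ring

theorem IsLeviHypersurface.D1_DT_sub {f : Base → ℝ} (h : IsLeviHypersurface φ U)
    (hf : ContDiffOn ℝ 2 f U) (hq : q ∈ U) :
    D1 φ (DT φ f) q - DT φ (D1 φ f) q = Phi1 φ q * DT φ f q := by
  have key := fderiv_apply_lieBracket (hf.contDiffAt (h.isOpen.mem_nhds hq)) (by simp)
    (h.differentiableAt_T hq) (h.differentiableAt_H1 hq)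
  rw [h.lieBracket_H1_T hq, map_smul] at key
  exact key.symm

theorem IsLeviHypersurface.D2_DT_sub {f : Base → ℝ} (h : IsLeviHypersurface φ U)
    (hf : ContDiffOn ℝ 2 f U) (hq : q ∈ U) :
    D2 φ (DT φ f) q - DT φ (D2 φ f) q = Phi2 φ q * DT φ f q := by
  have key := fderiv_apply_lieBracket (hf.contDiffAt (h.isOpen.mem_nhds hq)) (by simp)
    (h.differentiableAt_T hq) (h.differentiableAt_H2 hq)
  rw [h.lieBracket_H2_T hq, map_smul] at key
  exact key.symm

theorem fderiv_const_mul_sub_apply {f g : Base → ℝ} {c : ℝ} (hf : DifferentiableAt ℝ f q)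
    (hg : DifferentiableAt ℝ g q) (v : Base) :
    fderiv ℝ (fun x => c * (f x - g x)) q v = c * (fderiv ℝ f q v - fderiv ℝ g q v) := by
  simp [((hf.hasFDerivAt.fun_sub hg.hasFDerivAt).const_mul c).fderiv]

/-- `[H₁, [H₁, H₂]](f) = Φ₁ [H₁, H₂](f)`. -/
theorem IsLeviHypersurface.D1_D1_D2 {f : Base → ℝ} (h : IsLeviHypersurface φ U)
    (hf : ContDiffOn ℝ 3 f U) (hq : q ∈ U) :
    D1 φ (D1 φ (D2 φ f)) q - 2 * D1 φ (D2 φ (D1 φ f)) q + D2 φ (D1 φ (D1 φ f)) q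
      = Phi1 φ q * (D1 φ (D2 φ f) q - D2 φ (D1 φ f) q) := by
  have h2 : ContDiffOn ℝ 2 f U := hf.of_le (by norm_num)
  have c1 : ContDiffOn ℝ 2 (D1 φ f) U :=
    h.contDiffOn_D1 (k := 6) h.contDiffOn hf (by norm_num) (by norm_num)
  have c2 : ContDiffOn ℝ 2 (D2 φ f) U :=
    h.contDiffOn_D2 (k := 6) h.contDiffOn hf (by norm_num) (by norm_num)
  have c12 : DifferentiableAt ℝ (D1 φ (D2 φ f)) q :=
    ((h.contDiffOn_D1 (n := 1) (k := 6) h.contDiffOn c2 (by norm_num) (by norm_num)).contDiffAt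
      (h.isOpen.mem_nhds hq)).differentiableAt (by norm_num)
  have c21 : DifferentiableAt ℝ (D2 φ (D1 φ f)) q :=
    ((h.contDiffOn_D2 (n := 1) (k := 6) h.contDiffOn c1 (by norm_num) (by norm_num)).contDiffAt
      (h.isOpen.mem_nhds hq)).differentiableAt (by norm_num)
  -- The formula for `T(f)` holds on all of the open set `U`, so it may be differentiated.
  have e1 : D1 φ (DT φ f) q = 1 / 4 * (D1 φ (D1 φ (D2 φ f)) q - D1 φ (D2 φ (D1 φ f)) q) := by
    rw [h.D1_congr (fun x hx => h.DT_eq h2 hx) hq]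
    exact fderiv_const_mul_sub_apply c12 c21 _
  have e2 := h.D1_DT_sub h2 hq
  rw [e1, h.DT_eq h2 hq, h.DT_eq c1 hq] at e2
  linear_combination 4 * e2

/-- `[H₂, [H₁, H₂]](f) = Φ₂ [H₁, H₂](f)`. -/
theorem IsLeviHypersurface.D2_D1_D2 {f : Base → ℝ} (h : IsLeviHypersurface φ U)
    (hf : ContDiffOn ℝ 3 f U) (hq : q ∈ U) :
    2 * D2 φ (D1 φ (D2 φ f)) q - D2 φ (D2 φ (D1 φ f)) q - D1 φ (D2 φ (D2 φ f)) q
      = Phi2 φ q * (D1 φ (D2 φ f) q - D2 φ (D1 φ f) q) := by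
  have h2 : ContDiffOn ℝ 2 f U := hf.of_le (by norm_num)
  have c1 : ContDiffOn ℝ 2 (D1 φ f) U :=
    h.contDiffOn_D1 (k := 6) h.contDiffOn hf (by norm_num) (by norm_num)
  have c2 : ContDiffOn ℝ 2 (D2 φ f) U :=
    h.contDiffOn_D2 (k := 6) h.contDiffOn hf (by norm_num) (by norm_num)
  have c12 : DifferentiableAt ℝ (D1 φ (D2 φ f)) q :=
    ((h.contDiffOn_D1 (n := 1) (k := 6) h.contDiffOn c2 (by norm_num) (by norm_num)).contDiffAt
      (h.isOpen.mem_nhds hq)).differentiableAt (by norm_num)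
  have c21 : DifferentiableAt ℝ (D2 φ (D1 φ f)) q :=
    ((h.contDiffOn_D2 (n := 1) (k := 6) h.contDiffOn c1 (by norm_num) (by norm_num)).contDiffAt
      (h.isOpen.mem_nhds hq)).differentiableAt (by norm_num)
  have e1 : D2 φ (DT φ f) q = 1 / 4 * (D2 φ (D1 φ (D2 φ f)) q - D2 φ (D2 φ (D1 φ f)) q) := by
    rw [h.D2_congr (fun x hx => h.DT_eq h2 hx) hq]
    exact fderiv_const_mul_sub_apply c12 c21 _
  have e2 := h.D2_DT_sub h2 hq
  rw [e1, h.DT_eq h2 hq, h.DT_eq c2 hq] at e2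
  linear_combination 4 * e2

theorem IsLeviHypersurface.contDiffOn_Phi1_three (h : IsLeviHypersurface φ U) :
    ContDiffOn ℝ 3 (Phi1 φ) U := h.contDiffOn_Phi1 h.contDiffOn (by norm_num)

theorem IsLeviHypersurface.contDiffOn_Phi2_three (h : IsLeviHypersurface φ U) :
    ContDiffOn ℝ 3 (Phi2 φ) U := h.contDiffOn_Phi2 h.contDiffOn (by norm_num)

/-- `H₁(Φ₂) = H₂(Φ₁)`, the Jacobi identity for `H₁, H₂, T`. -/
theorem IsLeviHypersurface.D1_Phi2 (h : IsLeviHypersurface φ U) (hq : q ∈ U) :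
    D1 φ (Phi2 φ) q = D2 φ (Phi1 φ) q := by
  have hn := h.isOpen.mem_nhds hq
  have cT : ContDiffAt ℝ 4 (T φ) q :=
    (contDiffOn_T h.isOpen h.contDiffOn (by norm_num)).contDiffAt hn
  have dT := h.differentiableAt_T hq
  have jac := leibniz_identity_lieBracket (𝕜 := ℝ) (n := 2) (by simp)
    ((contDiffOn_H1 (n := 2) h.isOpen h.contDiffOn (by norm_num)).contDiffAt hn)
    ((contDiffOn_H2 (n := 2) h.isOpen h.contDiffOn (by norm_num)).contDiffAt hn)
    (cT.of_le (by norm_num))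
  have d1 : DifferentiableAt ℝ (Phi1 φ) q :=
    (h.contDiffOn_Phi1_three.contDiffAt hn).differentiableAt (by norm_num)
  have d2 : DifferentiableAt ℝ (Phi2 φ) q :=
    (h.contDiffOn_Phi2_three.contDiffAt hn).differentiableAt (by norm_num)
  have e1 : lieBracket ℝ (H1 φ) (T φ) =ᶠ[𝓝 q] fun x => Phi1 φ x • T φ x :=
    eventually_of_mem hn fun x hx => h.lieBracket_H1_T hx
  have e2 : lieBracket ℝ (H2 φ) (T φ) =ᶠ[𝓝 q] fun x => Phi2 φ x • T φ x :=
    eventually_of_mem hn fun x hx => h.lieBracket_H2_T hx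
  have e3 : lieBracket ℝ (H1 φ) (H2 φ) = (4 : ℝ) • T φ := funext fun _ => lieBracket_H1_H2
  rw [EventuallyEq.rfl.lieBracket_vectorField_eq e2, EventuallyEq.rfl.lieBracket_vectorField_eq e1,
    e3, lieBracket_const_smul_left dT, lieBracket_self, lieBracket_smul_right d1 dT,
    lieBracket_smul_right d2 dT, h.lieBracket_H1_T hq, h.lieBracket_H2_T hq] at jac
  -- Here `[[H₁, H₂], T] = 4[T, T]` has dropped out, and the two double brackets contain the same
  -- term `Φ₁Φ₂ T`. What remains is `H₁(Φ₂) T = H₂(Φ₁) T`, read off in the `∂ᵤ`-component.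
  have j2 := congrFun jac 2
  simp only [Pi.zero_apply, smul_zero, Pi.add_apply, Pi.smul_apply, smul_eq_mul, zero_add] at j2
  refine mul_right_cancel₀ (h.T_apply_two_ne_zero hq) ?_
  unfold D1 D2
  linear_combination j2

/-! ### The matrix `α` as a polynomial in fifteen variables, and its directional derivatives -/

/-- The matrix `α` as a function of `a, b, c, d, e, Φ₁, Φ₂, P, K₁, K₂, M₁, M₂, N₁, N₂, Q`. -/
noncomputable def alphaOf (x : Fin 15 → ℝ) : Matrix (Fin 8) (Fin 8) ℝ :=
  let a := x 0
  let b := x 1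
  let c := x 2
  let d := x 3
  let e := x 4
  let F1 := x 5
  let F2 := x 6
  let P := x 7
  let r := c ^ 2 + d ^ 2
  let s := a ^ 2 + b ^ 2
  let td := 1 / 2 * (b * d - a * c) * F1 - 1 / 2 * (b * c + a * d) * F2 - 2 * e
  let tr := 1 / 32 * P * r - 1 / 2 * (a * d + b * c) * F1 + 1 / 2 * (a * c - b * d) * F2
    + 3 * a ^ 2 + 3 * b ^ 2
  let ti1 := 1 / 192 * (x 8 * c + x 9 * d) * r + 1 / 16 * P * b * r
    - 1 / 2 * (F1 * c + F2 * d) * s + 2 * b * s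
  let ti2 := 1 / 192 * (x 9 * c - x 8 * d) * r - 1 / 16 * P * a * r
    - 1 / 2 * (F2 * c - F1 * d) * s - 2 * a * s
  let tj := x 14 * r ^ 2
    + 1 / 32 * (x 13 * (a * c - b * d) + x 12 * (a * d + b * c)) * r
    + 3 / 16 * P * s * r
    + (F2 * (a * c - b * d) - F1 * (a * d + b * c)) * s
    - 2 * e * (F1 * (a * c - b * d) + F2 * (a * d + b * c))
    + 3 * s ^ 2 - 4 * e ^ 2
  let h1d := -2 * b + 1 / 2 * F1 * c + 1 / 2 * F2 * d
  let h1r := -6 * a - 1 / 2 * F2 * c + 1 / 2 * F1 * d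
  let h1i1 := 1 / 2 * (b * d + a * c) * F1 - 1 / 2 * (b * c - a * d) * F2 - 4 * a * b - 2 * e
  let h1i2 := 1 / 32 * P * r + 1 / 2 * (b * c - a * d) * F1 + 1 / 2 * (a * c + b * d) * F2
    + 3 * a ^ 2 - b ^ 2
  let h1j := 1 / 96 * (x 10 * c + x 11 * d) * r - 1 / 8 * P * a * r
    - (F2 * c - F1 * d) * s + 2 * e * (F1 * c + F2 * d) - 8 * b * e - 4 * a * s
  let h2d := 2 * a + 1 / 2 * F2 * c - 1 / 2 * F1 * d
  let h2r := -6 * b + 1 / 2 * F1 * c + 1 / 2 * F2 * d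
  let h2i1 := -(1 / 32) * P * r + 1 / 2 * (b * c - a * d) * F1 + 1 / 2 * (a * c + b * d) * F2
    + a ^ 2 - 3 * b ^ 2
  let h2i2 := -(1 / 2) * (a * c + b * d) * F1 - 1 / 2 * (a * d - b * c) * F2 + 4 * a * b - 2 * e
  let h2j := 1 / 96 * (x 11 * c - x 10 * d) * r - 1 / 8 * P * b * r
    + (F1 * c + F2 * d) * s + 2 * e * (F2 * c - F1 * d) + 8 * a * e - 4 * b * s
  !![r, b * d - a * c, -(a * d) - b * c, td, tr, ti1, ti2, tj;
     0, c, d, h1d, h1r, h1i1, h1i2, h1j;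
     0, -d, c, h2d, h2r, h2i1, h2i2, h2j;
     0, 0, 0, 1, 0, 0, 0, 0;
     0, 0, 0, 0, 1, 0, 0, 0;
     0, 0, 0, 0, 0, 1, 0, 0;
     0, 0, 0, 0, 0, 0, 1, 0;
     0, 0, 0, 0, 0, 0, 0, 1]

/-- The directional derivative of `alphaOf` at `x` along `y`. -/
noncomputable def dAlphaOf (x y : Fin 15 → ℝ) : Matrix (Fin 8) (Fin 8) ℝ :=
  let a := x 0
  let b := x 1
  let c := x 2
  let d := x 3
  let e := x 4
  let F1 := x 5
  let F2 := x 6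
  let P := x 7
  let a' := y 0
  let b' := y 1
  let c' := y 2
  let d' := y 3
  let e' := y 4
  let F1' := y 5
  let F2' := y 6
  let P' := y 7
  let r := c ^ 2 + d ^ 2
  let r' := 2 * (c * c' + d * d')
  let s := a ^ 2 + b ^ 2
  let s' := 2 * (a * a' + b * b')
  let g := a * c - b * d
  let g' := a' * c + a * c' - b' * d - b * d'
  let h := a * d + b * c
  let h' := a' * d + a * d' + b' * c + b * c'
  let m := a * c + b * d
  let m' := a' * c + a * c' + b' * d + b * d'
  let n := b * c - a * d
  let n' := b' * c + b * c' - a' * d - a * d'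
  let k := F1 * c + F2 * d
  let k' := F1' * c + F1 * c' + F2' * d + F2 * d'
  let l := F2 * c - F1 * d
  let l' := F2' * c + F2 * c' - F1' * d - F1 * d'
  let td := -(1 / 2) * (g' * F1 + g * F1' + h' * F2 + h * F2') - 2 * e'
  let tr := 1 / 32 * (P' * r + P * r') - 1 / 2 * (h' * F1 + h * F1') + 1 / 2 * (g' * F2 + g * F2')
    + 3 * s'
  let ti1 := 1 / 192 * ((y 8 * c + x 8 * c' + y 9 * d + x 9 * d') * r + (x 8 * c + x 9 * d) * r')
    + 1 / 16 * (P' * b * r + P * b' * r + P * b * r') - 1 / 2 * (k' * s + k * s')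
    + 2 * (b' * s + b * s')
  let ti2 := 1 / 192 * ((y 9 * c + x 9 * c' - y 8 * d - x 8 * d') * r + (x 9 * c - x 8 * d) * r')
    - 1 / 16 * (P' * a * r + P * a' * r + P * a * r') - 1 / 2 * (l' * s + l * s')
    - 2 * (a' * s + a * s')
  let tj := y 14 * r ^ 2 + 2 * x 14 * r * r'
    + 1 / 32 * ((y 13 * g + x 13 * g' + y 12 * h + x 12 * h') * r + (x 13 * g + x 12 * h) * r')
    + 3 / 16 * (P' * s * r + P * s' * r + P * s * r')
    + (F2' * g + F2 * g' - F1' * h - F1 * h') * s + (F2 * g - F1 * h) * s'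
    - 2 * e' * (F1 * g + F2 * h) - 2 * e * (F1' * g + F1 * g' + F2' * h + F2 * h')
    + 6 * s * s' - 8 * e * e'
  let h1d := -2 * b' + 1 / 2 * k'
  let h1r := -6 * a' - 1 / 2 * l'
  let h1i1 := 1 / 2 * (m' * F1 + m * F1' - n' * F2 - n * F2') - 4 * (a' * b + a * b') - 2 * e'
  let h1i2 := 1 / 32 * (P' * r + P * r') + 1 / 2 * (n' * F1 + n * F1' + m' * F2 + m * F2')
    + 6 * a * a' - 2 * b * b'
  let h1j := 1 / 96 * ((y 10 * c + x 10 * c' + y 11 * d + x 11 * d') * r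
      + (x 10 * c + x 11 * d) * r')
    - 1 / 8 * (P' * a * r + P * a' * r + P * a * r') - (l' * s + l * s')
    + 2 * (e' * k + e * k') - 8 * (b' * e + b * e') - 4 * (a' * s + a * s')
  let h2d := 2 * a' + 1 / 2 * l'
  let h2r := -6 * b' + 1 / 2 * k'
  let h2i1 := -(1 / 32) * (P' * r + P * r') + 1 / 2 * (n' * F1 + n * F1' + m' * F2 + m * F2')
    + 2 * a * a' - 6 * b * b'
  let h2i2 := -(1 / 2) * (m' * F1 + m * F1' - n' * F2 - n * F2') + 4 * (a' * b + a * b') - 2 * e'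
  let h2j := 1 / 96 * ((y 11 * c + x 11 * c' - y 10 * d - x 10 * d') * r
      + (x 11 * c - x 10 * d) * r')
    - 1 / 8 * (P' * b * r + P * b' * r + P * b * r') + (k' * s + k * s')
    + 2 * (e' * l + e * l') + 8 * (a' * e + a * e') - 4 * (b' * s + b * s')
  !![r', -g', -h', td, tr, ti1, ti2, tj;
     0, c', d', h1d, h1r, h1i1, h1i2, h1j;
     0, -d', c', h2d, h2r, h2i1, h2i2, h2j;
     0, 0, 0, 0, 0, 0, 0, 0;
     0, 0, 0, 0, 0, 0, 0, 0;
     0, 0, 0, 0, 0, 0, 0, 0;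
     0, 0, 0, 0, 0, 0, 0, 0;
     0, 0, 0, 0, 0, 0, 0, 0]

theorem hasDerivAt_fun_sq {f : ℝ → ℝ} {f' t : ℝ} (hf : HasDerivAt f f' t) :
    HasDerivAt (fun t => f t ^ 2) (2 * f t * f') t := by
  simpa using hf.fun_pow 2

/-- A derivative of the last variable `Q` is demanded for the entry `α_{tj}` only, the one place
where `Q` occurs; all other entries remain differentiable when `Q` is merely continuous. -/
theorem hasDerivAt_alphaOf {x : ℝ → Fin 15 → ℝ} {y : Fin 15 → ℝ} {t : ℝ} {i l : Fin 8}
    (hx : ∀ k, k ≠ 14 → HasDerivAt (fun t => x t k) (y k) t)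
    (hQ : i = 0 → l = 7 → HasDerivAt (fun t => x t 14) (y 14) t) :
    HasDerivAt (fun t => alphaOf (x t) i l) (dAlphaOf (x t) y i l) t := by
  have h0 := hx 0 (by decide)
  have h1 := hx 1 (by decide)
  have h2 := hx 2 (by decide)
  have h3 := hx 3 (by decide)
  have h4 := hx 4 (by decide)
  have h5 := hx 5 (by decide)
  have h6 := hx 6 (by decide)
  have h7 := hx 7 (by decide)
  have h8 := hx 8 (by decide)
  have h9 := hx 9 (by decide)
  have h10 := hx 10 (by decide)
  have h11 := hx 11 (by decide)
  have h12 := hx 12 (by decide)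
  have h13 := hx 13 (by decide)
  have hc : ∀ r : ℝ, HasDerivAt (fun _ : ℝ => r) 0 t := fun r => hasDerivAt_const t r
  fin_cases i <;> fin_cases l <;>
  simp only [alphaOf, dAlphaOf, Matrix.of_apply, Matrix.cons_val', Matrix.cons_val, Fin.isValue,
    Fin.zero_eta, Fin.mk_one, Fin.reduceFinMk] <;>
  -- The derivative is left open and assembled by the differentiation rules, then compared with the
  -- entry of `dAlphaOf` by `ring`. Reducible transparency makes the rules follow the syntax of the
  -- polynomial.
  refine HasDerivAt.congr_deriv (by with_reducible
      repeat' first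
        | exact hc _ | exact h0 | exact h1 | exact h2 | exact h3 | exact h4 | exact h5 | exact h6
        | exact h7 | exact h8 | exact h9 | exact h10 | exact h11 | exact h12 | exact h13
        | exact hQ rfl rfl
        | apply HasDerivAt.fun_add | apply HasDerivAt.fun_sub | apply HasDerivAt.fun_mul
        | apply HasDerivAt.fun_neg | apply hasDerivAt_fun_sq) ?_ <;>
  ring

/-! ### Regularity of the coefficient functions on the base -/

/-- The functions `Φᵢ` cost three derivatives of `φ` (for `Hᵢ`, for `T`, and for the bracket of the
two), and each further `H₁` or `H₂` costs one more. The parameter `n` serves the classes `𝒞⁶` and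
`𝒞⁷` at once. -/
theorem IsLeviHypersurface.coeff_regularity {n : ℕ} (h : IsLeviHypersurface φ U)
    (hφ : ContDiffOn ℝ (n + 6 : ℕ) φ U) :
    (ContDiffOn ℝ (n + 3 : ℕ) (Phi1 φ) U ∧ ContDiffOn ℝ (n + 3 : ℕ) (Phi2 φ) U) ∧
    ContDiffOn ℝ (n + 2 : ℕ) (cP φ) U ∧
    (ContDiffOn ℝ (n + 1 : ℕ) (cK1 φ) U ∧ ContDiffOn ℝ (n + 1 : ℕ) (cK2 φ) U) ∧
    (ContDiffOn ℝ (n + 1 : ℕ) (cM1 φ) U ∧ ContDiffOn ℝ (n + 1 : ℕ) (cM2 φ) U) ∧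
    (ContDiffOn ℝ (n + 1 : ℕ) (cN1 φ) U ∧ ContDiffOn ℝ (n + 1 : ℕ) (cN2 φ) U) ∧
    ContDiffOn ℝ n (cQ φ) U := by
  have f0 : ContDiffOn ℝ (n + 3 : ℕ) (Phi1 φ) U := h.contDiffOn_Phi1 hφ (by norm_cast)
  have g0 : ContDiffOn ℝ (n + 3 : ℕ) (Phi2 φ) U := h.contDiffOn_Phi2 hφ (by norm_cast)
  have d1 : ∀ {m : ℕ} {f : Base → ℝ}, m ≤ n + 5 → ContDiffOn ℝ (m + 1 : ℕ) f U →
      ContDiffOn ℝ m (D1 φ f) U := fun hm hf =>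
    h.contDiffOn_D1 hφ hf (by norm_cast) (by norm_cast; omega)
  have d2 : ∀ {m : ℕ} {f : Base → ℝ}, m ≤ n + 5 → ContDiffOn ℝ (m + 1 : ℕ) f U →
      ContDiffOn ℝ m (D2 φ f) U := fun hm hf =>
    h.contDiffOn_D2 hφ hf (by norm_cast) (by norm_cast; omega)
  have f1 := d1 (m := n + 2) (by omega) f0
  have f2 := d2 (m := n + 2) (by omega) f0
  have g1 := d1 (m := n + 2) (by omega) g0
  have g2 := d2 (m := n + 2) (by omega) g0
  have f11 := d1 (m := n + 1) (by omega) f1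
  have f21 := d2 (m := n + 1) (by omega) f1
  have g12 := d1 (m := n + 1) (by omega) g2
  have g22 := d2 (m := n + 1) (by omega) g2
  have g11 := d1 (m := n + 1) (by omega) g1
  have g21 := d2 (m := n + 1) (by omega) g1
  have f111 := d1 (m := n) (by omega) f11
  have f221 := d2 (m := n) (by omega) f21
  have g222 := d2 (m := n) (by omega) g22
  have g112 := d1 (m := n) (by omega) g12
  have g121 := d1 (m := n) (by omega) g21
  have g211 := d2 (m := n) (by omega) g11
  have lo : ∀ {m m' : ℕ} {f : Base → ℝ}, m' ≤ m → ContDiffOn ℝ m f U →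
    ContDiffOn ℝ m' f U := fun hm hf => hf.of_le (by exact_mod_cast hm)
  have a0 := lo (m' := n + 1) (by omega) f0
  have b0 := lo (m' := n + 1) (by omega) g0
  have a1 := lo (m' := n + 1) (by omega) f1
  have b2 := lo (m' := n + 1) (by omega) g2
  have q : ∀ {f : Base → ℝ}, ContDiffOn ℝ (n + 1 : ℕ) f U → ContDiffOn ℝ n f U :=
    fun hf => lo (by omega) hf
  have c : ∀ (r : ℝ) {m : ℕ}, ContDiffOn ℝ m (fun _ : Base => r) U := fun _ _ => contDiffOn_const
  refine ⟨⟨f0, g0⟩, f1.add g2, ⟨?_, ?_⟩, ⟨?_, ?_⟩, ⟨?_, ?_⟩, ?_⟩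
  · exact ((((a0.mul a1).add (a0.mul b2)).sub f11).sub ((c 5).mul g12)).add ((c 4).mul g21)
  · exact ((((b0.mul a1).add (b0.mul b2)).sub g22).sub ((c 5).mul f21)).add ((c 4).mul g11)
  · exact ((((b0.mul a1).add (b0.mul b2)).sub g22).add ((c 7).mul f21)).sub ((c 8).mul g11)
  · exact ((((a0.mul a1).neg.sub (a0.mul b2)).add f11).sub ((c 7).mul g12)).add ((c 8).mul g21)
  · exact (((a0.mul a1).add (a0.mul b2)).sub f11).sub g12
  · exact (((b0.mul a1).neg.sub (b0.mul b2)).add f21).add g22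
  · have a0 := q a0
    have b0 := q b0
    have a1 := q a1
    have b2 := q b2
    have f11 := q f11
    have f21 := q f21
    have g12 := q g12
    have g22 := q g22
    have g11 := q g11
    have g21 := q g21
    exact ((((((((((((((((c _).mul f111).add ((c _).mul g222)).sub ((c _).mul g112)).sub
      ((c _).mul f221)).add ((c _).mul g121)).add ((c _).mul g211)).sub
      ((c _).mul (a0.mul f11))).sub ((c _).mul (b0.mul g22))).add ((c _).mul (a0.mul g12))).add
      ((c _).mul (b0.mul f21))).sub ((c _).mul (a0.mul g21))).sub ((c _).mul (b0.mul g11))).add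
      (((c _).mul ((a0.pow 2).add (b0.pow 2))).mul (a1.add b2))).sub
      ((c _).mul (a1.pow 2))).sub ((c _).mul (b2.pow 2))).sub ((c _).mul (a1.mul b2))

/-! ### The frame of the bundle and derivatives along it -/

/-- The tangent vector of `𝒫` at `p` with coordinates `w` in the frame
`T, H₁, H₂, D, R, I₁, I₂, J`. -/
noncomputable def comb (φ : Base → ℝ) (p : Tot) (w : Fin 8 → ℝ) : Tot :=
  Matrix.vecMul w (Matrix.of (frame φ p))

theorem hat_eq_comb (x : Alg) (p : Tot) :
    hat φ x p = comb φ p (Matrix.vecMul x (alpha φ p)) := by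
  exact (Matrix.vecMul_vecMul x (alpha φ p) (Matrix.of (frame φ p))).symm

theorem comb_add (w z : Fin 8 → ℝ) : comb φ p (w + z) = comb φ p w + comb φ p z :=
  Matrix.add_vecMul _ _ _

theorem comb_smul (r : ℝ) (w : Fin 8 → ℝ) : comb φ p (r • w) = r • comb φ p w :=
  Matrix.smul_vecMul _ _ _

/-- Over `U` the field `T` is a multiple of `∂ᵤ`, and the `∂ₓ`- and `∂_y`-components of `H₁, H₂` are
constant, so only the three `∂ᵤ`-components enter as functions on the base. -/
theorem IsLeviHypersurface.comb_eq (h : IsLeviHypersurface φ U) (hp : p ∈ bundle U)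
    (w : Fin 8 → ℝ) : comb φ p w =
    ![w 1, w 2, w 0 * T φ (base p) 2 + w 1 * H1 φ (base p) 2 + w 2 * H2 φ (base p) 2,
      -p 3 * w 3 - p 4 * w 4 + w 5, -p 4 * w 3 + p 3 * w 4 + w 6, -p 5 * w 3 + p 6 * w 4,
      -p 6 * w 3 - p 5 * w 4, -2 * p 7 * w 3 - p 4 * w 5 + p 3 * w 6 + w 7 / 2] := by
  have t0 := h.T_apply_zero hp.1
  have t1 := h.T_apply_one hp.1
  ext k
  simp only [comb, Matrix.vecMul, dotProduct, Matrix.of_apply]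
  fin_cases k <;> simp [Fin.sum_univ_eight, frame, horiz, t0, t1, H1, H2] <;> ring

theorem IsLeviHypersurface.base_comb (h : IsLeviHypersurface φ U) (hp : p ∈ bundle U)
    (w : Fin 8 → ℝ) : base (comb φ p w) =
      w 0 • T φ (base p) + w 1 • H1 φ (base p) + w 2 • H2 φ (base p) := by
  have t0 := h.T_apply_zero hp.1
  have t1 := h.T_apply_one hp.1
  rw [h.comb_eq hp]
  generalize base p = q at *
  ext k
  simp only [Pi.add_apply, Pi.smul_apply, smul_eq_mul]
  fin_cases k
  · simp [base, H1, H2, t0]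
  · simp [base, H1, H2, t1]
  · rfl

/-- The `∂ₓ`- and `∂_y`-components give the coefficients of `H₁, H₂`, and `∂ᵤ` then gives that of
`T`. On `(∂_c, ∂_d)` the fields `D, R` have determinant `c² + d² ≠ 0`; after that the coefficients
of `I₁, I₂, J` are determined one after the other. -/
theorem IsLeviHypersurface.comb_injective (h : IsLeviHypersurface φ U) (hp : p ∈ bundle U) :
    Function.Injective (comb φ p) := by
  have key : ∀ w, comb φ p w = 0 → w = 0 := by
    intro w hw
    rw [h.comb_eq hp] at hw
    have hr := hp.2
    have e0 : w 1 = 0 := congrFun hw 0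
    have e1 : w 2 = 0 := congrFun hw 1
    have e2 : w 0 * T φ (base p) 2 + w 1 * H1 φ (base p) 2 + w 2 * H2 φ (base p) 2 = 0 :=
      congrFun hw 2
    have e3 : -p 3 * w 3 - p 4 * w 4 + w 5 = 0 := congrFun hw 3
    have e4 : -p 4 * w 3 + p 3 * w 4 + w 6 = 0 := congrFun hw 4
    have e5 : -p 5 * w 3 + p 6 * w 4 = 0 := congrFun hw 5
    have e6 : -p 6 * w 3 - p 5 * w 4 = 0 := congrFun hw 6
    have e7 : -2 * p 7 * w 3 - p 4 * w 5 + p 3 * w 6 + w 7 / 2 = 0 := congrFun hw 7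
    have w3 : w 3 = 0 := by
      refine (mul_eq_zero.1 (?_ : (p 5 ^ 2 + p 6 ^ 2) * w 3 = 0)).resolve_left hr
      linear_combination -p 5 * e5 - p 6 * e6
    have w4 : w 4 = 0 := by
      refine (mul_eq_zero.1 (?_ : (p 5 ^ 2 + p 6 ^ 2) * w 4 = 0)).resolve_left hr
      linear_combination p 6 * e5 - p 5 * e6
    have w0 : w 0 = 0 := by
      simpa [e0, e1, h.T_apply_two_ne_zero hp.1] using e2
    have w5 : w 5 = 0 := by simpa [w3, w4] using e3
    have w6 : w 6 = 0 := by simpa [w3, w4] using e4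
    have w7 : w 7 = 0 := by simpa [w3, w5, w6] using e7
    ext k
    fin_cases k <;> assumption
  intro w z hwz
  refine sub_eq_zero.1 (key _ ?_)
  rw [comb, Matrix.sub_vecMul]
  exact sub_eq_zero.2 hwz

/-- The variables `a, b, c, d, e, Φ₁, Φ₂, P, K₁, K₂, M₁, M₂, N₁, N₂, Q` at `p`. -/
noncomputable def coords (φ : Base → ℝ) (p : Tot) : Fin 15 → ℝ :=
  ![p 3, p 4, p 5, p 6, p 7, Phi1 φ (base p), Phi2 φ (base p), cP φ (base p), cK1 φ (base p),
    cK2 φ (base p), cM1 φ (base p), cM2 φ (base p), cN1 φ (base p), cN2 φ (base p), cQ φ (base p)]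

theorem alpha_eq_alphaOf (p : Tot) : alpha φ p = alphaOf (coords φ p) := rfl

/-- The derivatives of the variables `coords` along `comb φ p w`. -/
noncomputable def dCoords (φ : Base → ℝ) (p : Tot) (w : Fin 8 → ℝ) : Fin 15 → ℝ :=
  let δ : (Base → ℝ) → ℝ := fun f =>
    w 0 * DT φ f (base p) + w 1 * D1 φ f (base p) + w 2 * D2 φ f (base p)
  ![-p 3 * w 3 - p 4 * w 4 + w 5, -p 4 * w 3 + p 3 * w 4 + w 6, -p 5 * w 3 + p 6 * w 4,
    -p 6 * w 3 - p 5 * w 4, -2 * p 7 * w 3 - p 4 * w 5 + p 3 * w 6 + w 7 / 2,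
    δ (Phi1 φ), δ (Phi2 φ), δ (cP φ), δ (cK1 φ), δ (cK2 φ), δ (cM1 φ), δ (cM2 φ), δ (cN1 φ),
    δ (cN2 φ), δ (cQ φ)]

theorem base_add_smul (p v : Tot) (t : ℝ) : base (p + t • v) = base p + t • base v := by
  ext k
  fin_cases k <;> simp [base]

theorem hasLineDerivAt_apply (p v : Tot) (k : Fin 8) :
    HasLineDerivAt ℝ (fun q : Tot => q k) (v k) p v := by
  simpa [HasLineDerivAt] using ((hasDerivAt_id (0 : ℝ)).mul_const (v k)).const_add (p k)

theorem IsLeviHypersurface.hasLineDerivAt_base (h : IsLeviHypersurface φ U) (hp : p ∈ bundle U)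
    (w : Fin 8 → ℝ) {f : Base → ℝ} (hf : DifferentiableAt ℝ f (base p)) :
    HasLineDerivAt ℝ (fun q => f (base q))
      (w 0 * DT φ f (base p) + w 1 * D1 φ f (base p) + w 2 * D2 φ f (base p)) p (comb φ p w) := by
  have := hf.hasFDerivAt.hasLineDerivAt (base (comb φ p w))
  simp only [h.base_comb hp, map_add, map_smul] at this
  simp only [HasLineDerivAt, base_add_smul, h.base_comb hp] at this ⊢
  exact this

theorem IsLeviHypersurface.hasLineDerivAt_coords (h : IsLeviHypersurface φ U)
    (hp : p ∈ bundle U) (w : Fin 8 → ℝ) {k : Fin 15} (hk : k ≠ 14) :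
    HasLineDerivAt ℝ (fun q => coords φ q k) (dCoords φ p w k) p (comb φ p w) := by
  obtain ⟨⟨f, g⟩, P, ⟨K1, K2⟩, ⟨M1, M2⟩, ⟨N1, N2⟩, -⟩ :=
    h.coeff_regularity (n := 0) (by exact_mod_cast h.contDiffOn)
  have c : ∀ k : Fin 8, HasLineDerivAt ℝ (fun q : Tot => q k) (comb φ p w k) p (comb φ p w) :=
    fun k => hasLineDerivAt_apply p _ k
  rw [h.comb_eq hp] at c
  have b : ∀ {n : ℕ} {f : Base → ℝ}, n ≠ 0 → ContDiffOn ℝ n f U → HasLineDerivAt ℝ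
      (fun q => f (base q)) (w 0 * DT φ f (base p) + w 1 * D1 φ f (base p) + w 2 * D2 φ f (base p))
      p (comb φ p w) := fun hn hf =>
    h.hasLineDerivAt_base hp w ((hf.contDiffAt (h.isOpen.mem_nhds hp.1)).differentiableAt
      (by exact_mod_cast hn))
  rw [h.comb_eq hp] at b ⊢
  fin_cases k
  · exact c 3
  · exact c 4
  · exact c 5
  · exact c 6
  · exact c 7
  · exact b (by norm_num) f
  · exact b (by norm_num) g
  · exact b (by norm_num) P
  · exact b (by norm_num) K1
  · exact b (by norm_num) K2
  · exact b (by norm_num) M1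
  · exact b (by norm_num) M2
  · exact b (by norm_num) N1
  · exact b (by norm_num) N2
  · exact absurd rfl hk

/-- The condition on `w` lets `α_{tj}` be differentiated in vertical directions only, which is
possible even where `Q` is not differentiable. -/
theorem IsLeviHypersurface.hasLineDerivAt_alpha (h : IsLeviHypersurface φ U)
    (hp : p ∈ bundle U) (w : Fin 8 → ℝ) {i l : Fin 8}
    (hil : i = 0 → l = 7 → w 0 = 0 ∧ w 1 = 0 ∧ w 2 = 0) :
    HasLineDerivAt ℝ (fun q => alpha φ q i l)
      (dAlphaOf (coords φ p) (dCoords φ p w) i l) p (comb φ p w) := by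
  have key := hasDerivAt_alphaOf (x := fun t => coords φ (p + t • comb φ p w)) (t := 0)
    (y := dCoords φ p w) (i := i) (l := l)
    (fun k hk => h.hasLineDerivAt_coords hp w hk) (fun hi hl => by
      obtain ⟨w0, w1, w2⟩ := hil hi hl
      -- A vertical line stays over the same base point, so `Q` is constant on it.
      have hc : ∀ t : ℝ, coords φ (p + t • comb φ p w) 14 = cQ φ (base p) := fun t => by
        change cQ φ (base (p + t • comb φ p w)) = _
        rw [base_add_smul, h.base_comb hp, w0, w1, w2]
        simp
      have hd : dCoords φ p w 14 = 0 := by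
        change w 0 * _ + w 1 * _ + w 2 * _ = 0
        rw [w0, w1, w2]; ring
      simp only [hc, hd]
      exact hasDerivAt_const _ _)
  simp only [zero_smul, add_zero] at key
  exact key

/-- The bracket of two combinations of the frame `T, H₁, H₂, D, R, I₁, I₂, J` with constant
coefficients. -/
noncomputable def frameLie (φ : Base → ℝ) (q : Base) (v w : Fin 8 → ℝ) : Fin 8 → ℝ :=
  ![4 * (v 1 * w 2 - v 2 * w 1) + Phi1 φ q * (v 1 * w 0 - v 0 * w 1)
      + Phi2 φ q * (v 2 * w 0 - v 0 * w 2), 0, 0, 0, 0,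
    (v 3 * w 5 - v 5 * w 3) + (v 4 * w 6 - v 6 * w 4),
    (v 3 * w 6 - v 6 * w 3) - (v 4 * w 5 - v 5 * w 4),
    2 * (v 3 * w 7 - v 7 * w 3) + 4 * (v 5 * w 6 - v 6 * w 5)]

/-! ### Brackets of combinations of the frame -/

theorem continuous_base : Continuous base := by
  refine continuous_pi fun k => ?_
  fin_cases k
  · exact continuous_apply 0
  · exact continuous_apply 1
  · exact continuous_apply 2

theorem isOpen_bundle (hU : IsOpen U) : IsOpen (bundle U) := by
  refine (hU.preimage continuous_base).inter (isOpen_ne_fun (f := fun p : Tot => p 5 ^ 2 + p 6 ^ 2)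
    (g := fun _ => 0) ?_ continuous_const)
  fun_prop

theorem lieBracket_apply {V W : Base → Base} {q : Base} (hV : DifferentiableAt ℝ V q)
    (hW : DifferentiableAt ℝ W q) (k : Fin 3) : lieBracket ℝ V W q k =
      fderiv ℝ (fun x => W x k) q (V q) - fderiv ℝ (fun x => V x k) q (W q) := by
  rw [fderiv_apply hV, fderiv_apply hW]
  rfl

/-- The derivatives along `comb φ p u` of the components of a combination of the frame with
coefficients `z` and derivatives `z'` of the coefficients. -/
noncomputable def dComb (φ : Base → ℝ) (p : Tot) (u z z' : Fin 8 → ℝ) : Tot :=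
  let δ : (Base → ℝ) → ℝ := fun f =>
    u 0 * DT φ f (base p) + u 1 * D1 φ f (base p) + u 2 * D2 φ f (base p)
  let y := dCoords φ p u
  ![z' 1, z' 2,
    z' 0 * T φ (base p) 2 + z 0 * δ (fun q => T φ q 2)
      + (z' 1 * H1 φ (base p) 2 + z 1 * δ (fun q => H1 φ q 2))
      + (z' 2 * H2 φ (base p) 2 + z 2 * δ (fun q => H2 φ q 2)),
    -y 0 * z 3 - p 3 * z' 3 - y 1 * z 4 - p 4 * z' 4 + z' 5,
    -y 1 * z 3 - p 4 * z' 3 + y 0 * z 4 + p 3 * z' 4 + z' 6,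
    -y 2 * z 3 - p 5 * z' 3 + y 3 * z 4 + p 6 * z' 4,
    -y 3 * z 3 - p 6 * z' 3 - y 2 * z 4 - p 5 * z' 4,
    -2 * y 4 * z 3 - 2 * p 7 * z' 3 - y 1 * z 5 - p 4 * z' 5 + y 0 * z 6 + p 3 * z' 6 + z' 7 / 2]

/-- The condition `l = 7 → k = 7` reflects that `J = ½ ∂ₑ`: the coefficient of `J` is invisible in
all components except `∂ₑ`, so elsewhere it need not be differentiable. -/
theorem IsLeviHypersurface.hasLineDerivAt_comb (h : IsLeviHypersurface φ U)
    (hp : p ∈ bundle U) {z : Tot → Fin 8 → ℝ} {u z' : Fin 8 → ℝ} {k : Fin 8}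
    (hz : ∀ l, (l = 7 → k = 7) →
      HasLineDerivAt ℝ (fun q => z q l) (z' l) p (comb φ p u)) :
    HasLineDerivAt ℝ (fun q => comb φ q (z q) k) (dComb φ p u (z p) z' k) p (comb φ p u) := by
  have hev : ∀ᶠ q in 𝓝 p, q ∈ bundle U := (isOpen_bundle h.isOpen).mem_nhds hp
  refine HasLineDerivAt.congr_of_eventuallyEq ?_ (hev.mono fun q hq => by
    change comb φ q (z q) k = _
    rw [h.comb_eq hq])
  have a : HasLineDerivAt ℝ (fun q : Tot => q 3) (dCoords φ p u 0) p (comb φ p u) :=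
    h.hasLineDerivAt_coords hp u (k := 0) (by decide)
  have b : HasLineDerivAt ℝ (fun q : Tot => q 4) (dCoords φ p u 1) p (comb φ p u) :=
    h.hasLineDerivAt_coords hp u (k := 1) (by decide)
  have c : HasLineDerivAt ℝ (fun q : Tot => q 5) (dCoords φ p u 2) p (comb φ p u) :=
    h.hasLineDerivAt_coords hp u (k := 2) (by decide)
  have d : HasLineDerivAt ℝ (fun q : Tot => q 6) (dCoords φ p u 3) p (comb φ p u) :=
    h.hasLineDerivAt_coords hp u (k := 3) (by decide)
  have e : HasLineDerivAt ℝ (fun q : Tot => q 7) (dCoords φ p u 4) p (comb φ p u) :=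
    h.hasLineDerivAt_coords hp u (k := 4) (by decide)
  have t := h.hasLineDerivAt_base hp u (differentiableAt_pi.1 (h.differentiableAt_T hp.1) 2)
  have h1 := h.hasLineDerivAt_base hp u (differentiableAt_pi.1 (h.differentiableAt_H1 hp.1) 2)
  have h2 := h.hasLineDerivAt_base hp u (differentiableAt_pi.1 (h.differentiableAt_H2 hp.1) 2)
  unfold HasLineDerivAt at *
  have z0 := hz 0 (by simp)
  have z1 := hz 1 (by simp)
  have z2 := hz 2 (by simp)
  have z3 := hz 3 (by simp)
  have z4 := hz 4 (by simp)
  have z5 := hz 5 (by simp)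
  have z6 := hz 6 (by simp)
  fin_cases k
  · exact z1
  · exact z2
  · refine (((z0.fun_mul t).fun_add (z1.fun_mul h1)).fun_add (z2.fun_mul h2)).congr_deriv ?_
    simp [dComb]
  · refine (((a.fun_neg.fun_mul z3).fun_sub (b.fun_mul z4)).fun_add z5).congr_deriv ?_
    simp [dComb]; ring
  · refine (((b.fun_neg.fun_mul z3).fun_add (a.fun_mul z4)).fun_add z6).congr_deriv ?_
    simp [dComb]; ring
  · refine ((c.fun_neg.fun_mul z3).fun_add (d.fun_mul z4)).congr_deriv ?_
    simp [dComb]; ring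
  · refine ((d.fun_neg.fun_mul z3).fun_sub (c.fun_mul z4)).congr_deriv ?_
    simp [dComb]; ring
  · have z7 := hz 7 (by simp)
    refine (((((e.const_mul (-2)).fun_mul z3).fun_sub (b.fun_mul z5)).fun_add
      (a.fun_mul z6)).fun_add (z7.div_const 2)).congr_deriv ?_
    simp [dComb]; ring

/-- This is the Leibniz rule `[V, W] = ∑ (V(wᵢ) - W(vᵢ)) Xᵢ + ∑ vᵢ wⱼ [Xᵢ, Xⱼ]` for the frame `Xᵢ`.
The brackets of the base fields are felt only in the `∂ᵤ`-component; the others involve explicit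
vertical fields. -/
theorem IsLeviHypersurface.lieBr_comb (h : IsLeviHypersurface φ U) (hp : p ∈ bundle U)
    {v w : Tot → Fin 8 → ℝ} {v' w' : Fin 8 → ℝ} {k : Fin 8}
    (hv : ∀ l, (l = 7 → k = 7) →
      HasLineDerivAt ℝ (fun q => v q l) (v' l) p (comb φ p (w p)))
    (hw : ∀ l, (l = 7 → k = 7) →
      HasLineDerivAt ℝ (fun q => w q l) (w' l) p (comb φ p (v p))) :
    lieBr (fun q => comb φ q (v q)) (fun q => comb φ q (w q)) p k =
      comb φ p (w' - v' + frameLie φ (base p) (v p) (w p)) k := by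
  rw [lieBr, along, along, (h.hasLineDerivAt_comb hp hv).lineDeriv,
    (h.hasLineDerivAt_comb hp hw).lineDeriv, h.comb_eq hp]
  have r12 : D1 φ (fun q => H2 φ q 2) (base p) - D2 φ (fun q => H1 φ q 2) (base p)
      = 4 * T φ (base p) 2 := by
    have := lieBracket_apply (h.differentiableAt_H1 hp.1) (h.differentiableAt_H2 hp.1) 2
    rw [lieBracket_H1_H2] at this
    exact this.symm
  have r1 : D1 φ (fun q => T φ q 2) (base p) - DT φ (fun q => H1 φ q 2) (base p)
      = Phi1 φ (base p) * T φ (base p) 2 := by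
    have := lieBracket_apply (h.differentiableAt_H1 hp.1) (h.differentiableAt_T hp.1) 2
    rw [h.lieBracket_H1_T hp.1] at this
    exact this.symm
  have r2 : D2 φ (fun q => T φ q 2) (base p) - DT φ (fun q => H2 φ q 2) (base p)
      = Phi2 φ (base p) * T φ (base p) 2 := by
    have := lieBracket_apply (h.differentiableAt_H2 hp.1) (h.differentiableAt_T hp.1) 2
    rw [h.lieBracket_H2_T hp.1] at this
    exact this.symm
  fin_cases k
  · simp [dComb, frameLie]
  · simp [dComb, frameLie]
  · simp [dComb, frameLie]
    linear_combination (v p 1 * w p 2 - v p 2 * w p 1) * r12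
      + (v p 1 * w p 0 - v p 0 * w p 1) * r1 + (v p 2 * w p 0 - v p 0 * w p 2) * r2
  all_goals
    simp [dComb, dCoords, frameLie]
    ring

/-! ### Derivatives of the coefficient functions -/

/-- The functions `N₁, N₂, Q` are left out because they occur only in `α_{tj}`, whose horizontal
derivatives play no role. -/
theorem IsLeviHypersurface.fderiv_coeff {q : Base} (h : IsLeviHypersurface φ U) (hq : q ∈ U)
    (v : Base) :
    fderiv ℝ (cP φ) q v = fderiv ℝ (D1 φ (Phi1 φ)) q v + fderiv ℝ (D2 φ (Phi2 φ)) q v ∧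
    fderiv ℝ (cK1 φ) q v = fderiv ℝ (Phi1 φ) q v * cP φ q
      + Phi1 φ q * fderiv ℝ (D1 φ (Phi1 φ)) q v + Phi1 φ q * fderiv ℝ (D2 φ (Phi2 φ)) q v
      - fderiv ℝ (D1 φ (D1 φ (Phi1 φ))) q v - 5 * fderiv ℝ (D1 φ (D2 φ (Phi2 φ))) q v
      + 4 * fderiv ℝ (D2 φ (D1 φ (Phi2 φ))) q v ∧
    fderiv ℝ (cK2 φ) q v = fderiv ℝ (Phi2 φ) q v * cP φ q
      + Phi2 φ q * fderiv ℝ (D1 φ (Phi1 φ)) q v + Phi2 φ q * fderiv ℝ (D2 φ (Phi2 φ)) q v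
      - fderiv ℝ (D2 φ (D2 φ (Phi2 φ))) q v - 5 * fderiv ℝ (D2 φ (D1 φ (Phi1 φ))) q v
      + 4 * fderiv ℝ (D1 φ (D1 φ (Phi2 φ))) q v ∧
    fderiv ℝ (cM1 φ) q v = fderiv ℝ (Phi2 φ) q v * cP φ q
      + Phi2 φ q * fderiv ℝ (D1 φ (Phi1 φ)) q v + Phi2 φ q * fderiv ℝ (D2 φ (Phi2 φ)) q v
      - fderiv ℝ (D2 φ (D2 φ (Phi2 φ))) q v + 7 * fderiv ℝ (D2 φ (D1 φ (Phi1 φ))) q v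
      - 8 * fderiv ℝ (D1 φ (D1 φ (Phi2 φ))) q v ∧
    fderiv ℝ (cM2 φ) q v = -(fderiv ℝ (Phi1 φ) q v * cP φ q)
      - Phi1 φ q * fderiv ℝ (D1 φ (Phi1 φ)) q v - Phi1 φ q * fderiv ℝ (D2 φ (Phi2 φ)) q v
      + fderiv ℝ (D1 φ (D1 φ (Phi1 φ))) q v - 7 * fderiv ℝ (D1 φ (D2 φ (Phi2 φ))) q v
      + 8 * fderiv ℝ (D2 φ (D1 φ (Phi2 φ))) q v := by
  have d1 : ∀ {m : ℕ} {f : Base → ℝ}, m ≤ 5 → ContDiffOn ℝ (m + 1 : ℕ) f U →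
      ContDiffOn ℝ m (D1 φ f) U := fun hm hf =>
    h.contDiffOn_D1 (k := 6) h.contDiffOn hf (by norm_cast) (by norm_cast; omega)
  have d2 : ∀ {m : ℕ} {f : Base → ℝ}, m ≤ 5 → ContDiffOn ℝ (m + 1 : ℕ) f U →
      ContDiffOn ℝ m (D2 φ f) U := fun hm hf =>
    h.contDiffOn_D2 (k := 6) h.contDiffOn hf (by norm_cast) (by norm_cast; omega)
  have f0 := h.contDiffOn_Phi1_three
  have g0 := h.contDiffOn_Phi2_three
  have f1 := d1 (m := 2) (by omega) f0
  have g1 := d1 (m := 2) (by omega) g0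
  have g2 := d2 (m := 2) (by omega) g0
  have H : ∀ {n : ℕ} {f : Base → ℝ}, n ≠ 0 → ContDiffOn ℝ n f U →
      HasLineDerivAt ℝ f (fderiv ℝ f q v) q v := fun hn hf =>
    ((hf.contDiffAt (h.isOpen.mem_nhds hq)).differentiableAt
      (by exact_mod_cast hn)).hasFDerivAt.hasLineDerivAt v
  have f11 := H (by norm_num) (d1 (m := 1) (by omega) f1)
  have f21 := H (by norm_num) (d2 (m := 1) (by omega) f1)
  have g12 := H (by norm_num) (d1 (m := 1) (by omega) g2)
  have g22 := H (by norm_num) (d2 (m := 1) (by omega) g2)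
  have g11 := H (by norm_num) (d1 (m := 1) (by omega) g1)
  have g21 := H (by norm_num) (d2 (m := 1) (by omega) g1)
  have f1 := H (by norm_num) f1
  have g2 := H (by norm_num) g2
  have f0 := H (n := 3) (by norm_num) f0
  have g0 := H (n := 3) (by norm_num) g0
  obtain ⟨-, P, ⟨K1, K2⟩, ⟨M1, M2⟩, -⟩ :=
    h.coeff_regularity (n := 0) (by exact_mod_cast h.contDiffOn)
  have P := H (by norm_num) P
  have K1 := H (by norm_num) K1
  have K2 := H (by norm_num) K2
  have M1 := H (by norm_num) M1
  have M2 := H (by norm_num) M2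
  unfold HasLineDerivAt at *
  refine ⟨P.unique (f1.fun_add g2), ?_, ?_, ?_, ?_⟩
  · rw [K1.unique (((((f0.fun_mul f1).fun_add (f0.fun_mul g2)).fun_sub f11).fun_sub
      (g12.const_mul 5)).fun_add (g21.const_mul 4))]
    simp only [zero_smul, add_zero, cP]; ring
  · rw [K2.unique (((((g0.fun_mul f1).fun_add (g0.fun_mul g2)).fun_sub g22).fun_sub
      (f21.const_mul 5)).fun_add (g11.const_mul 4))]
    simp only [zero_smul, add_zero, cP]; ring
  · rw [M1.unique (((((g0.fun_mul f1).fun_add (g0.fun_mul g2)).fun_sub g22).fun_add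
      (f21.const_mul 7)).fun_sub (g11.const_mul 8))]
    simp only [zero_smul, add_zero, cP]; ring
  · rw [M2.unique (((((f0.fun_mul f1).fun_neg.fun_sub (f0.fun_mul g2)).fun_add f11).fun_sub
      (g12.const_mul 7)).fun_add (g21.const_mul 8))]
    simp only [zero_smul, add_zero, cP]; ring

/-! ### The structure equations -/

theorem vecMul_algBasis (i : Fin 8) (M : Matrix (Fin 8) (Fin 8) ℝ) :
    Matrix.vecMul (algBasis i) M = M i := by
  have h : algBasis i = (Pi.single i (1 : ℝ) : Fin 8 → ℝ) := Pi.basisFun_apply ℝ (Fin 8) i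
  rw [h, Matrix.single_one_vecMul]
  rfl

theorem hat_algBasis (i : Fin 8) :
    hat φ (algBasis i) = fun q => comb φ q (alpha φ q i) :=
  funext fun q => by rw [hat_eq_comb, vecMul_algBasis]

/-- The coefficients of `[X̂ᵢ, X̂ⱼ]` in the frame `T, H₁, H₂, D, R, I₁, I₂, J`. -/
noncomputable def bracketCoeff (φ : Base → ℝ) (p : Tot) (i j : Fin 8) : Fin 8 → ℝ :=
  dAlphaOf (coords φ p) (dCoords φ p (alpha φ p i)) j
    - dAlphaOf (coords φ p) (dCoords φ p (alpha φ p j)) i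
    + frameLie φ (base p) (alpha φ p i) (alpha φ p j)

/-- For a bracket with `T̂` the `∂ₑ`-component is excluded, since it may contain a derivative of `Q`
that does not exist. -/
theorem IsLeviHypersurface.lieBr_hat_apply (h : IsLeviHypersurface φ U) (hp : p ∈ bundle U)
    {i j k : Fin 8} (hk : i = 0 ∨ j = 0 → k ≠ 7) :
    lieBr (hat φ (algBasis i)) (hat φ (algBasis j)) p k = comb φ p (bracketCoeff φ p i j) k := by
  rw [hat_algBasis, hat_algBasis]
  exact h.lieBr_comb hp
    (fun l hl => h.hasLineDerivAt_alpha hp _ fun hi hl' => absurd (hl hl') (hk (.inl hi)))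
    (fun l hl => h.hasLineDerivAt_alpha hp _ fun hj hl' => absurd (hl hl') (hk (.inr hj)))

theorem vecMul_alpha_of_vertical {x : Alg} (x0 : x 0 = 0) (x1 : x 1 = 0) (x2 : x 2 = 0) (q : Tot) :
    Matrix.vecMul x (alpha φ q) = x := by
  rw [alpha_eq_alphaOf]
  generalize coords φ q = z
  ext l
  simp only [Matrix.vecMul, dotProduct, Fin.sum_univ_eight, x0, x1, x2]
  fin_cases l <;> simp [alphaOf, x0, x1, x2]

/-- The structure equations for a vertical and an arbitrary constant field, as polynomial
identities. -/
theorem vecMul_dAlphaOf_add_frameLie (z : Fin 15 → ℝ) (q : Base) {x : Alg} (y : Alg)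
    (x0 : x 0 = 0) (x1 : x 1 = 0) (x2 : x 2 = 0)
    (hN1 : z 12 = 2 / 3 * z 8 - 1 / 3 * z 11) (hN2 : z 13 = -(2 / 3) * z 9 - 1 / 3 * z 10)
    (l : Fin 8) :
    Matrix.vecMul y (dAlphaOf z ![-z 0 * x 3 - z 1 * x 4 + x 5, -z 1 * x 3 + z 0 * x 4 + x 6,
      -z 2 * x 3 + z 3 * x 4, -z 3 * x 3 - z 2 * x 4,
      -2 * z 4 * x 3 - z 1 * x 5 + z 0 * x 6 + x 7 / 2, 0, 0, 0, 0, 0, 0, 0, 0, 0, 0]) l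
      + frameLie φ q x (Matrix.vecMul y (alphaOf z)) l
      = Matrix.vecMul (⁅x, y⁆ : Alg) (alphaOf z) l := by
  have e : ∀ (u : Alg) (M : Matrix (Fin 8) (Fin 8) ℝ) (l : Fin 8), Matrix.vecMul u M l =
      u 0 * M 0 l + u 1 * M 1 l + u 2 * M 2 l + u 3 * M 3 l + u 4 * M 4 l + u 5 * M 5 l
        + u 6 * M 6 l + u 7 * M 7 l := fun u M l => by
    simp only [Matrix.vecMul, dotProduct, Fin.sum_univ_eight]
  rw [e, e]
  simp only [frameLie, e, x0, x1, x2, lie_apply]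
  fin_cases l <;>
  simp only [alphaOf, dAlphaOf, Matrix.of_apply, Matrix.cons_val', Matrix.cons_val, Fin.isValue,
    Fin.zero_eta, Fin.mk_one, Fin.reduceFinMk, hN1, hN2] <;>
  ring

theorem apply_eq_zero_of_mem_hSub {x : Alg} (hx : x ∈ hSub) : x 0 = 0 ∧ x 1 = 0 ∧ x 2 = 0 := by
  refine Submodule.span_induction (p := fun x _ => x 0 = 0 ∧ x 1 = 0 ∧ x 2 = 0) ?_ ?_ ?_ ?_ hx
  · rintro _ ⟨k, hk, rfl⟩
    refine ⟨?_, ?_, ?_⟩ <;> fin_cases k <;> simp [deg] at hk ⊢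
  · simp
  · rintro a b - - ⟨h0, h1, h2⟩ ⟨k0, k1, k2⟩
    simp [*]
  · rintro r a - ⟨h0, h1, h2⟩
    simp [*]

/-- The infinitesimal equivariance of the connection. -/
theorem IsLeviHypersurface.lieBr_hat_of_mem_hSub (h : IsLeviHypersurface φ U)
    (hp : p ∈ bundle U) {x : Alg} (hx : x ∈ hSub) (y : Alg) :
    lieBr (hat φ x) (hat φ y) p = hat φ ⁅x, y⁆ p := by
  obtain ⟨x0, x1, x2⟩ := apply_eq_zero_of_mem_hSub hx
  have e1 : hat φ x = fun q => comb φ q x := funext fun q => by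
    rw [hat_eq_comb, vecMul_alpha_of_vertical x0 x1 x2]
  have e2 : hat φ y = fun q => comb φ q (Matrix.vecMul y (alpha φ q)) :=
    funext fun q => hat_eq_comb y q
  have hw : ∀ l : Fin 8, HasLineDerivAt ℝ (fun q => Matrix.vecMul y (alpha φ q) l)
      (Matrix.vecMul y (dAlphaOf (coords φ p) (dCoords φ p x)) l) p (comb φ p x) := by
    intro l
    have := fun i => h.hasLineDerivAt_alpha hp x (i := i) (l := l) fun _ _ => ⟨x0, x1, x2⟩
    unfold HasLineDerivAt at this ⊢
    simp only [Matrix.vecMul, dotProduct]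
    exact HasDerivAt.fun_sum fun i _ => (this i).const_mul (y i)
  rw [e1, e2, hat_eq_comb]
  ext k
  rw [h.lieBr_comb hp (v := fun _ => x) (v' := 0) (fun l _ => hasDerivAt_const _ _)
    (fun l _ => hw l)]
  refine congrFun (congrArg (comb φ p) ?_) k
  rw [alpha_eq_alphaOf]
  -- The ten zeros are the derivatives of the base functions along a vertical vector.
  have hX : dCoords φ p x = ![-p 3 * x 3 - p 4 * x 4 + x 5, -p 4 * x 3 + p 3 * x 4 + x 6,
    -p 5 * x 3 + p 6 * x 4, -p 6 * x 3 - p 5 * x 4,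
    -2 * p 7 * x 3 - p 4 * x 5 + p 3 * x 6 + x 7 / 2, 0, 0, 0, 0, 0, 0, 0, 0, 0, 0] := by
    simp [dCoords, x0, x1, x2]
  rw [hX, sub_zero]
  -- The two relations for `N₁, N₂` are what the `J`-component of `[Îₖ, T̂] = -Ĥₖ` requires.
  refine funext (vecMul_dAlphaOf_add_frameLie (coords φ p) (base p) y x0 x1 x2 ?_ ?_)
  · change cN1 φ (base p) = 2 / 3 * cK1 φ (base p) - 1 / 3 * cM2 φ (base p)
    unfold cN1 cK1 cM2; ring
  · change cN2 φ (base p) = -(2 / 3) * cK2 φ (base p) - 1 / 3 * cM1 φ (base p)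
    unfold cN2 cK2 cM1; ring

/-! ### The structure equations for the horizontal constant fields -/

/-- `H₁(Φ₂) = H₂(Φ₁)` and its derivatives. -/
theorem IsLeviHypersurface.derivatives_D1_Phi2 (h : IsLeviHypersurface φ U) (hq : q ∈ U) :
    D1 φ (D1 φ (Phi2 φ)) q = D1 φ (D2 φ (Phi1 φ)) q ∧
    D2 φ (D1 φ (Phi2 φ)) q = D2 φ (D2 φ (Phi1 φ)) q ∧
    D1 φ (D1 φ (D1 φ (Phi2 φ))) q = D1 φ (D1 φ (D2 φ (Phi1 φ))) q ∧
    D1 φ (D2 φ (D1 φ (Phi2 φ))) q = D1 φ (D2 φ (D2 φ (Phi1 φ))) q ∧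
    D2 φ (D1 φ (D1 φ (Phi2 φ))) q = D2 φ (D1 φ (D2 φ (Phi1 φ))) q ∧
    D2 φ (D2 φ (D1 φ (Phi2 φ))) q = D2 φ (D2 φ (D2 φ (Phi1 φ))) q := by
  have e1 : ∀ x ∈ U, D1 φ (D1 φ (Phi2 φ)) x = D1 φ (D2 φ (Phi1 φ)) x :=
    fun x hx => h.D1_congr (fun y hy => h.D1_Phi2 hy) hx
  have e2 : ∀ x ∈ U, D2 φ (D1 φ (Phi2 φ)) x = D2 φ (D2 φ (Phi1 φ)) x :=
    fun x hx => h.D2_congr (fun y hy => h.D1_Phi2 hy) hx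
  exact ⟨e1 q hq, e2 q hq, h.D1_congr e1 hq, h.D1_congr e2 hq, h.D2_congr e1 hq, h.D2_congr e2 hq⟩

/-- The relations between the derivatives of `Φ₁` and `Φ₂` of order three along `H₁, H₂`. -/
theorem IsLeviHypersurface.third_order_relations (h : IsLeviHypersurface φ U) (hq : q ∈ U) :
    D2 φ (D1 φ (D1 φ (Phi1 φ))) q = 2 * D1 φ (D2 φ (D1 φ (Phi1 φ))) q
      - D1 φ (D1 φ (D2 φ (Phi1 φ))) q
      + Phi1 φ q * (D1 φ (D2 φ (Phi1 φ)) q - D2 φ (D1 φ (Phi1 φ)) q) ∧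
    D1 φ (D2 φ (D2 φ (Phi1 φ))) q = 2 * D2 φ (D1 φ (D2 φ (Phi1 φ))) q
      - D2 φ (D2 φ (D1 φ (Phi1 φ))) q
      - Phi2 φ q * (D1 φ (D2 φ (Phi1 φ)) q - D2 φ (D1 φ (Phi1 φ)) q) ∧
    D1 φ (D1 φ (D2 φ (Phi2 φ))) q = 3 * D2 φ (D1 φ (D2 φ (Phi1 φ))) q
      - 2 * D2 φ (D2 φ (D1 φ (Phi1 φ))) q
      - 2 * (Phi2 φ q * (D1 φ (D2 φ (Phi1 φ)) q - D2 φ (D1 φ (Phi1 φ)) q))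
      + Phi1 φ q * (D1 φ (D2 φ (Phi2 φ)) q - D2 φ (D2 φ (Phi1 φ)) q) ∧
    D1 φ (D2 φ (D2 φ (Phi2 φ))) q = 2 * D2 φ (D1 φ (D2 φ (Phi2 φ))) q
      - D2 φ (D2 φ (D2 φ (Phi1 φ))) q
      - Phi2 φ q * (D1 φ (D2 φ (Phi2 φ)) q - D2 φ (D2 φ (Phi1 φ)) q) := by
  have f1 := h.D1_D1_D2 h.contDiffOn_Phi1_three hq
  have f2 := h.D2_D1_D2 h.contDiffOn_Phi1_three hq
  have g1 := h.D1_D1_D2 h.contDiffOn_Phi2_three hq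
  have g2 := h.D2_D1_D2 h.contDiffOn_Phi2_three hq
  obtain ⟨-, e2, -, e4, e5, e6⟩ := h.derivatives_D1_Phi2 hq
  -- With `H₁Φ₂` replaced by `H₂Φ₁` inside every derivative, the relations for `Φ₁` and `Φ₂` share
  -- third-order terms. They can then be solved for four of them, to be used as rewriting rules.
  rw [e2, e4, e5] at g1
  rw [e2, e6] at g2
  refine ⟨?_, ?_, ?_, ?_⟩
  · linear_combination f1
  · linear_combination -f2
  -- The relation for `Φ₂` contains `2 H₁H₂H₂Φ₁`, which the second relation for `Φ₁` eliminates.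
  · linear_combination g1 - 2 * f2
  · linear_combination -g2

/-- Since `T = ¼[H₁, H₂]`, derivatives along `T` can be traded for commutators, after which only
words in `H₁, H₂` remain. -/
theorem IsLeviHypersurface.DT_coeff (h : IsLeviHypersurface φ U) (hq : q ∈ U) :
    DT φ (Phi1 φ) q = 1 / 4 * (D1 φ (D2 φ (Phi1 φ)) q - D2 φ (D1 φ (Phi1 φ)) q) ∧
    DT φ (Phi2 φ) q = 1 / 4 * (D1 φ (D2 φ (Phi2 φ)) q - D2 φ (D1 φ (Phi2 φ)) q) ∧
    DT φ (cP φ) q = 1 / 4 * (D1 φ (D2 φ (D1 φ (Phi1 φ))) q - D2 φ (D1 φ (D1 φ (Phi1 φ))) q)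
      + 1 / 4 * (D1 φ (D2 φ (D2 φ (Phi2 φ))) q - D2 φ (D1 φ (D2 φ (Phi2 φ))) q) := by
  have f0 := h.contDiffOn_Phi1_three
  have g0 := h.contDiffOn_Phi2_three
  have f1 : ContDiffOn ℝ 2 (D1 φ (Phi1 φ)) U :=
    h.contDiffOn_D1 (k := 6) h.contDiffOn f0 (by norm_num) (by norm_num)
  have g2 : ContDiffOn ℝ 2 (D2 φ (Phi2 φ)) U :=
    h.contDiffOn_D2 (k := 6) h.contDiffOn g0 (by norm_num) (by norm_num)
  refine ⟨h.DT_eq (f0.of_le (by norm_num)) hq, h.DT_eq (g0.of_le (by norm_num)) hq, ?_⟩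
  rw [← h.DT_eq f1 hq, ← h.DT_eq g2 hq]
  exact (h.fderiv_coeff hq _).1

/-- The structure functions of `Ĥ₁, Ĥ₂` are those of the Lie algebra. Those of `T̂, Ĥᵢ` differ from
them by the curvature, which is tracefree with values in `ℝi₁ ⊕ ℝi₂ ⊕ ℝj`. -/
theorem IsLeviHypersurface.bracketCoeff_horizontal (h : IsLeviHypersurface φ U)
    (hp : p ∈ bundle U) :
    (∀ l, bracketCoeff φ p 1 2 l = 4 * alpha φ p 0 l) ∧
    (∀ l < 5, bracketCoeff φ p 0 1 l = 0) ∧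
    (∀ l < 5, bracketCoeff φ p 0 2 l = 0) ∧
    bracketCoeff φ p 0 1 5 + bracketCoeff φ p 0 2 6 = 0 := by
  have hq := hp.1
  obtain ⟨P1, K11, K21, M11, M21⟩ := h.fderiv_coeff hq (H1 φ (base p))
  obtain ⟨P2, K12, K22, M12, M22⟩ := h.fderiv_coeff hq (H2 φ (base p))
  have u1 : ∀ f, fderiv ℝ f (base p) (H1 φ (base p)) = D1 φ f (base p) := fun _ => rfl
  have u2 : ∀ f, fderiv ℝ f (base p) (H2 φ (base p)) = D2 φ f (base p) := fun _ => rfl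
  simp only [u1, u2] at P1 K11 K21 M11 M21 P2 K12 K22 M12 M22
  obtain ⟨e1, e2, e3, e4, e5, e6⟩ := h.derivatives_D1_Phi2 hq
  obtain ⟨r1, r2, r3, r4⟩ := h.third_order_relations hq
  obtain ⟨t1, t2, t3⟩ := h.DT_coeff hq
  have e0 := h.D1_Phi2 hq
  refine ⟨fun l => ?_, fun l hl => ?_, fun l hl => ?_, ?_⟩
  all_goals try fin_cases l
  all_goals try exact absurd hl (by decide)
  all_goals
    simp only [bracketCoeff, alpha_eq_alphaOf, Pi.add_apply, Pi.sub_apply, frameLie, alphaOf,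
      dAlphaOf, dCoords, coords, Matrix.of_apply, Matrix.cons_val', Matrix.cons_val, Fin.isValue,
      Fin.zero_eta, Fin.mk_one, Fin.reduceFinMk]
    -- Normal form: no derivatives along `T`, no `H₁Φ₂`, and third-order derivatives reduced by the
    -- four relations. The remaining derivatives can be treated as independent variables by `ring`.
    try simp only [t1, t2, t3, P1, K11, K21, M11, M21, P2, K12, K22, M12, M22, e0, e1, e2, e3, e4,
      e5, e6, r1, r2, r3, r4, cP, cK1, cK2, cM1, cM2, cN1, cN2, cQ]
    ring

/-! ### Regularity of the constant fields -/

theorem contDiff_base {n : WithTop ℕ∞} : ContDiff ℝ n base := by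
  refine contDiff_pi.2 fun k => ?_
  fin_cases k
  · exact contDiff_apply ℝ ℝ 0
  · exact contDiff_apply ℝ ℝ 1
  · exact contDiff_apply ℝ ℝ 2

theorem contDiffOn_comp_base {n : WithTop ℕ∞} {f : Base → ℝ} (hf : ContDiffOn ℝ n f U) :
    ContDiffOn ℝ n (fun p => f (base p)) (bundle U) :=
  hf.comp contDiff_base.contDiffOn fun _ hp => hp.1

theorem contDiff_alphaOf {n : WithTop ℕ∞} (i l : Fin 8) :
    ContDiff ℝ n (fun x => alphaOf x i l) := by
  fin_cases i <;> fin_cases l <;>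
  simp only [alphaOf, Matrix.of_apply, Matrix.cons_val', Matrix.cons_val, Fin.isValue,
    Fin.zero_eta, Fin.mk_one, Fin.reduceFinMk] <;>
  fun_prop

/-- `Q` occurs in `α_{tj}` only. -/
theorem alphaOf_update (x : Fin 15 → ℝ) (r : ℝ) {i l : Fin 8} (hil : ¬(i = 0 ∧ l = 7)) :
    alphaOf (Function.update x 14 r) i l = alphaOf x i l := by
  have h : ∀ k, k ≠ 14 → Function.update x 14 r k = x k := fun k hk => Function.update_of_ne hk r x
  have h0 := h 0 (by decide)
  have h1 := h 1 (by decide)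
  have h2 := h 2 (by decide)
  have h3 := h 3 (by decide)
  have h4 := h 4 (by decide)
  have h5 := h 5 (by decide)
  have h6 := h 6 (by decide)
  have h7 := h 7 (by decide)
  have h8 := h 8 (by decide)
  have h9 := h 9 (by decide)
  have h10 := h 10 (by decide)
  have h11 := h 11 (by decide)
  fin_cases i <;> fin_cases l <;>
  first
  | simp only [alphaOf, h0, h1, h2, h3, h4, h5, h6, h7, h8, h9, h10, h11, Matrix.of_apply,
      Matrix.cons_val', Matrix.cons_val, Fin.isValue, Fin.zero_eta, Fin.mk_one, Fin.reduceFinMk]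
    done
  | exact absurd ⟨rfl, rfl⟩ hil

theorem IsLeviHypersurface.contDiffOn_alpha {n : ℕ} (h : IsLeviHypersurface φ U)
    (hφ : ContDiffOn ℝ (n + 6 : ℕ) φ U) (i l : Fin 8) :
    ContDiffOn ℝ n (fun p => alpha φ p i l) (bundle U) ∧
    (¬(i = 0 ∧ l = 7) → ContDiffOn ℝ (n + 1 : ℕ) (fun p => alpha φ p i l) (bundle U)) := by
  obtain ⟨⟨f, g⟩, P, ⟨K1, K2⟩, ⟨M1, M2⟩, ⟨N1, N2⟩, Q⟩ := h.coeff_regularity hφ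
  have B : ∀ {m : ℕ} {f : Base → ℝ}, n + 1 ≤ m → ContDiffOn ℝ m f U →
      ContDiffOn ℝ (n + 1 : ℕ) (fun p => f (base p)) (bundle U) := fun hm hf =>
    contDiffOn_comp_base (hf.of_le (by exact_mod_cast hm))
  have C : ∀ k : Fin 8, ContDiffOn ℝ (n + 1 : ℕ) (fun p : Tot => p k) (bundle U) :=
    fun k => (contDiff_apply ℝ ℝ k).contDiffOn
  have key : ∀ k : Fin 15, k ≠ 14 →
      ContDiffOn ℝ (n + 1 : ℕ) (fun p => coords φ p k) (bundle U) := by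
    intro k hk
    fin_cases k
    · exact C 3
    · exact C 4
    · exact C 5
    · exact C 6
    · exact C 7
    · exact B (by omega) f
    · exact B (by omega) g
    · exact B (by omega) P
    · exact B (by omega) K1
    · exact B (by omega) K2
    · exact B (by omega) M1
    · exact B (by omega) M2
    · exact B (by omega) N1
    · exact B (by omega) N2
    · exact absurd rfl hk
  constructor
  · refine (contDiff_alphaOf i l).comp_contDiffOn (f := coords φ) (contDiffOn_pi.2 fun k => ?_)
    by_cases hk : k = 14
    · subst hk
      exact contDiffOn_comp_base Q
    · exact (key k hk).of_le (by exact_mod_cast Nat.le_succ n)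
  · intro hil
    -- Setting `Q` to zero does not change this entry and removes the only coordinate that lacks the
    -- extra derivative.
    have e : (fun p => alpha φ p i l) =
        fun p => alphaOf (Function.update (coords φ p) 14 0) i l :=
      funext fun p => (alphaOf_update (coords φ p) 0 hil).symm
    rw [e]
    refine (contDiff_alphaOf i l).comp_contDiffOn
      (f := fun p => Function.update (coords φ p) 14 0) (contDiffOn_pi.2 fun k => ?_)
    by_cases hk : k = 14
    · subst hk
      simpa using contDiffOn_const
    · simpa [Function.update_of_ne hk] using key k hk

/-- The bound `n ≤ 4` is the regularity of `T`, which takes two of the six derivatives of `φ`. -/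
theorem IsLeviHypersurface.contDiffOn_comb {n : ℕ} (h : IsLeviHypersurface φ U) (hn : n ≤ 4)
    {z : Tot → Fin 8 → ℝ} {k : Fin 8}
    (hz : ∀ l, (l = 7 → k = 7) → ContDiffOn ℝ n (fun p => z p l) (bundle U)) :
    ContDiffOn ℝ n (fun p => comb φ p (z p) k) (bundle U) := by
  refine ContDiffOn.congr ?_ fun p hp => congrFun (h.comb_eq hp (z p)) k
  have c : ∀ k : Fin 8, ContDiffOn ℝ n (fun p : Tot => p k) (bundle U) :=
    fun k => (contDiff_apply ℝ ℝ k).contDiffOn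
  have hφ := h.contDiffOn
  have n4 : ((n : ℕ) : WithTop ℕ∞) ≤ 4 := by exact_mod_cast hn
  have t := contDiffOn_comp_base (contDiffOn_pi.1
    ((contDiffOn_T (n := 4) h.isOpen hφ (by norm_num)).of_le n4) 2)
  have h1 := contDiffOn_comp_base (contDiffOn_pi.1
    ((contDiffOn_H1 (n := 4) h.isOpen hφ (by norm_num)).of_le n4) 2)
  have h2 := contDiffOn_comp_base (contDiffOn_pi.1
    ((contDiffOn_H2 (n := 4) h.isOpen hφ (by norm_num)).of_le n4) 2)
  have z0 := hz 0 (by simp)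
  have z1 := hz 1 (by simp)
  have z2 := hz 2 (by simp)
  have z3 := hz 3 (by simp)
  have z4 := hz 4 (by simp)
  have z5 := hz 5 (by simp)
  have z6 := hz 6 (by simp)
  fin_cases k
  · exact z1
  · exact z2
  · exact ((z0.mul t).add (z1.mul h1)).add (z2.mul h2)
  · exact (((c 3).neg.mul z3).sub ((c 4).mul z4)).add z5
  · exact (((c 4).neg.mul z3).add ((c 3).mul z4)).add z6
  · exact ((c 5).neg.mul z3).add ((c 6).mul z4)
  · exact ((c 6).neg.mul z3).sub ((c 5).mul z4)
  · exact (((((contDiffOn_const (c := (-2 : ℝ))).mul (c 7)).mul z3).sub ((c 4).mul z5)).add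
      ((c 3).mul z6)).add ((hz 7 (by simp)).div_const 2)

/-! ### The connection form -/

/-- The last five rows are rows of the identity matrix. Expanding five times along the last row
leaves the block of `T, H₁, H₂`, which is triangular up to the rotation-dilation given by `c, d`. -/
theorem det_alphaOf (x : Fin 15 → ℝ) : (alphaOf x).det = (x 2 ^ 2 + x 3 ^ 2) ^ 2 := by
  have e : ∀ {n : ℕ} (M : Matrix (Fin (n + 1)) (Fin (n + 1)) ℝ),
      (∀ j : Fin n, M (Fin.last n) j.castSucc = 0) → M (Fin.last n) (Fin.last n) = 1 →
      M.det = (M.submatrix Fin.castSucc Fin.castSucc).det := by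
    intro n M h0 h1
    rw [Matrix.det_succ_row M (Fin.last n), Fin.sum_univ_castSucc]
    simp [h0, h1, ← two_mul]
  rw [e _ (by intro j; fin_cases j <;> rfl) rfl, e _ (by intro j; fin_cases j <;> rfl) rfl,
    e _ (by intro j; fin_cases j <;> rfl) rfl, e _ (by intro j; fin_cases j <;> rfl) rfl,
    e _ (by intro j; fin_cases j <;> rfl) rfl, Matrix.det_fin_three]
  change (x 2 ^ 2 + x 3 ^ 2) * x 2 * x 2 - (x 2 ^ 2 + x 3 ^ 2) * x 3 * (-x 3)
    - _ * 0 * x 2 + _ * x 3 * 0 + _ * 0 * (-x 3) - _ * x 2 * 0 = _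
  ring

theorem omegaInv_algBasis (i : Fin 8) : omegaInv φ p (algBasis i) = comb φ p (alpha φ p i) :=
  congrFun (hat_algBasis i) p

theorem IsLeviHypersurface.isUnit_hatMatrix (h : IsLeviHypersurface φ U) (hp : p ∈ bundle U) :
    IsUnit (hatMatrix φ p) := by
  refine IsUnit.mul ?_ (Matrix.vecMul_injective_iff_isUnit.1 (h.comb_injective hp))
  rw [Matrix.isUnit_iff_isUnit_det, alpha_eq_alphaOf, det_alphaOf, isUnit_iff_ne_zero]
  exact pow_ne_zero 2 hp.2

theorem IsLeviHypersurface.omega_omegaInv (h : IsLeviHypersurface φ U) (hp : p ∈ bundle U)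
    (x : Alg) : omega φ p (omegaInv φ p x) = x := by
  have hu := (Matrix.isUnit_iff_isUnit_det _).1 (h.isUnit_hatMatrix hp)
  change Matrix.vecMul (Matrix.vecMul x (hatMatrix φ p)) (hatMatrix φ p)⁻¹ = x
  refine (Matrix.vecMul_vecMul x (hatMatrix φ p) (hatMatrix φ p)⁻¹).trans ?_
  rw [Matrix.mul_nonsing_inv _ hu]
  exact Matrix.vecMul_one _

theorem IsLeviHypersurface.omegaInv_omega (h : IsLeviHypersurface φ U) (hp : p ∈ bundle U)
    (v : Tot) : omegaInv φ p (omega φ p v) = v := by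
  have hu := (Matrix.isUnit_iff_isUnit_det _).1 (h.isUnit_hatMatrix hp)
  change Matrix.vecMul (Matrix.vecMul v (hatMatrix φ p)⁻¹) (hatMatrix φ p) = v
  rw [Matrix.vecMul_vecMul, Matrix.nonsing_inv_mul _ hu, Matrix.vecMul_one]

theorem comb_eq_sum (w : Fin 8 → ℝ) : comb φ p w = ∑ i, w i • frame φ p i := by
  rw [comb, Matrix.vecMul_eq_sum]
  rfl

theorem IsLeviHypersurface.exists_basis (h : IsLeviHypersurface φ U) (hp : p ∈ bundle U) :
    ∃ B : Module.Basis (Fin 8) ℝ Tot, (∀ k, B k = frame φ p k) ∧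
      (LinearMap.toMatrix algBasis B (omegaInv φ p)).det = (p 5 ^ 2 + p 6 ^ 2) ^ 2 := by
  have hli : LinearIndependent ℝ (frame φ p) := by
    rw [Fintype.linearIndependent_iff]
    intro w hw
    rw [← comb_eq_sum] at hw
    have : w = 0 := h.comb_injective hp (hw.trans (Matrix.zero_vecMul _).symm)
    exact congrFun this
  let B := basisOfLinearIndependentOfCardEqFinrank hli (by simp)
  have hB : ∀ k, B k = frame φ p k := fun k => by simp [B]
  refine ⟨B, hB, ?_⟩
  -- Images of basis vectors are the columns of `toMatrix` but the rows of `alpha`.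
  have : LinearMap.toMatrix algBasis B (omegaInv φ p) = (alpha φ p).transpose := by
    ext i j
    have hs : comb φ p (alpha φ p j) = ∑ i, alpha φ p j i • B i := by
      simp only [comb_eq_sum, hB]
    rw [LinearMap.toMatrix_apply, omegaInv_algBasis, hs, B.repr_sum_self]
    rfl
  rw [this, Matrix.det_transpose, alpha_eq_alphaOf, det_alphaOf]
  rfl

theorem IsLeviHypersurface.omega_comb_of_vertical (h : IsLeviHypersurface φ U)
    (hp : p ∈ bundle U) {x : Alg} (x0 : x 0 = 0) (x1 : x 1 = 0) (x2 : x 2 = 0) :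
    omega φ p (comb φ p x) = x := by
  have : comb φ p x = hat φ x p := by rw [hat_eq_comb, vecMul_alpha_of_vertical x0 x1 x2]
  rw [this]
  exact h.omega_omegaInv hp x

theorem IsLeviHypersurface.omega_frame (h : IsLeviHypersurface φ U) (hp : p ∈ bundle U)
    {k : Fin 8} (hk : 3 ≤ k) : omega φ p (frame φ p k) = algBasis k := by
  have e : frame φ p k = comb φ p (algBasis k) := (vecMul_algBasis k (Matrix.of (frame φ p))).symm
  rw [e, h.omega_comb_of_vertical hp] <;> fin_cases k <;> simp at hk ⊢

/-! ### The curvature -/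

theorem Alg.neg_apply (x : Alg) (k : Fin 8) : (-x) k = -x k := rfl

theorem lieBr_swap (V W : Tot → Tot) (p : Tot) : lieBr W V p = -lieBr V W p := by
  ext k
  simp [lieBr]

/-- Near `p` the functions `ω(X̂)` and `ω(Ŷ)` are constant, so only the bracket term of `dω`
survives. -/
theorem IsLeviHypersurface.curvForm_hat (h : IsLeviHypersurface φ U) (hp : p ∈ bundle U)
    (x y : Alg) :
    curvForm φ (hat φ x) (hat φ y) p = ⁅x, y⁆ - omega φ p (lieBr (hat φ x) (hat φ y) p) := by
  have hc : ∀ (V : Tot → Tot) (z : Alg) (k : Fin 8),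
      along V (fun q => omega φ q (hat φ z q) k) p = 0 := by
    intro V z k
    have hev : (fun q => omega φ q (hat φ z q) k) =ᶠ[𝓝 p] fun _ => z k := by
      filter_upwards [(isOpen_bundle h.isOpen).mem_nhds hp] with q hq
      exact congrFun (h.omega_omegaInv hq z) k
    rw [along, hev.lineDeriv_eq]
    simp [lineDeriv]
  have e : ∀ z, omega φ p (hat φ z p) = z := h.omega_omegaInv hp
  rw [curvForm, e, e, dOmega]
  simp only [hc, sub_zero]
  have h0 : (fun _ : Fin 8 => (0 : ℝ)) = (0 : Alg) := rfl
  rw [h0, zero_sub, neg_add_eq_sub]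

theorem IsLeviHypersurface.curvForm_hat_swap (h : IsLeviHypersurface φ U) (hp : p ∈ bundle U)
    (x y : Alg) :
    curvForm φ (hat φ y) (hat φ x) p = -curvForm φ (hat φ x) (hat φ y) p := by
  rw [h.curvForm_hat hp, h.curvForm_hat hp, lieBr_swap, map_neg, ← lie_skew x y]
  abel

/-- For constant fields, infinitesimal equivariance is precisely the vanishing of the curvature on
vertical arguments. -/
theorem IsLeviHypersurface.curvForm_hat_of_mem_hSub (h : IsLeviHypersurface φ U)
    (hp : p ∈ bundle U) {x : Alg} (hx : x ∈ hSub) (y : Alg) :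
    curvForm φ (hat φ x) (hat φ y) p = 0 := by
  rw [h.curvForm_hat hp, h.lieBr_hat_of_mem_hSub hp hx]
  exact sub_eq_zero.2 (h.omega_omegaInv hp _).symm

theorem IsLeviHypersurface.curvForm_one_two (h : IsLeviHypersurface φ U) (hp : p ∈ bundle U) :
    curvForm φ (hat φ (algBasis 1)) (hat φ (algBasis 2)) p = 0 := by
  have e : lieBr (hat φ (algBasis 1)) (hat φ (algBasis 2)) p
      = omegaInv φ p ((4 : ℝ) • algBasis 0) := by
    rw [map_smul, omegaInv_algBasis, ← comb_smul]
    ext k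
    rw [h.lieBr_hat_apply hp (by simp)]
    exact congrFun (congrArg (comb φ p) (funext (h.bracketCoeff_horizontal hp).1)) k
  rw [h.curvForm_hat hp, e, h.omega_omegaInv hp, sub_eq_zero]
  ext k
  fin_cases k <;> simp [lie_apply]

/-- A tangent vector that agrees with a combination of the frame outside the `∂ₑ`-component differs
from it by a multiple of `J`. -/
theorem exists_eq_comb (X : Tot) (β : Fin 8 → ℝ) (hX : ∀ k, k ≠ 7 → X k = comb φ p β k) :
    ∃ w : Alg, (∀ l, l ≠ 7 → w l = β l) ∧ X = comb φ p w := by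
  -- The factor 2 compensates for `J = ½ ∂ₑ`.
  obtain ⟨r, hr⟩ : ∃ r : ℝ, r = 2 * (X 7 - comb φ p β 7) := ⟨_, rfl⟩
  refine ⟨β + r • Pi.single 7 1, fun l hl => ?_, ?_⟩
  · change β l + r * (Pi.single 7 1 : Fin 8 → ℝ) l = β l
    rw [Pi.single_eq_of_ne hl, mul_zero, add_zero]
  · have hJ : comb φ p (Pi.single 7 1) = frame φ p 7 := Matrix.single_one_vecMul _ _
    have hw : comb φ p (β + r • Pi.single 7 1) = comb φ p β + r • frame φ p 7 := by
      rw [comb_add, comb_smul, hJ]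
    refine Eq.trans ?_ hw.symm
    have f7 : ∀ k, k ≠ 7 → frame φ p 7 k = 0 := fun k hk => by
      fin_cases k <;> first | rfl | exact absurd rfl hk
    ext k
    simp only [Pi.add_apply, Pi.smul_apply, smul_eq_mul]
    by_cases hk : k = 7
    · have h7 : frame φ p 7 7 = 1 / 2 := rfl
      rw [hk, h7, hr]
      ring
    · rw [f7 k hk, hX k hk, mul_zero, add_zero]

/-- Since `[t, hᵢ] = 0`, the curvature is `-ω([T̂, Ĥᵢ])`. The bracket is known up to a multiple of
`J`; it is vertical, and `ω` reads off the frame coefficients of vertical vectors. The uncertainty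
thus stays in the `j`-component, about which nothing is claimed. -/
theorem IsLeviHypersurface.curvForm_zero_apply (h : IsLeviHypersurface φ U)
    (hp : p ∈ bundle U) {i : Fin 8} (hi : i = 1 ∨ i = 2)
    (hb : ∀ l < 5, bracketCoeff φ p 0 i l = 0) :
    (∀ l < 5, curvForm φ (hat φ (algBasis 0)) (hat φ (algBasis i)) p l = 0) ∧
    ∀ l, l = 5 ∨ l = 6 → curvForm φ (hat φ (algBasis 0)) (hat φ (algBasis i)) p l
      = -bracketCoeff φ p 0 i l := by
  obtain ⟨w, hw, e⟩ := exists_eq_comb (lieBr (hat φ (algBasis 0)) (hat φ (algBasis i)) p)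
    (bracketCoeff φ p 0 i) fun k hk => h.lieBr_hat_apply hp fun _ => hk
  have hlie : ⁅algBasis 0, algBasis i⁆ = 0 := by
    ext k
    rcases hi with rfl | rfl <;> fin_cases k <;> simp [lie_apply]
  have hc : curvForm φ (hat φ (algBasis 0)) (hat φ (algBasis i)) p = -w := by
    rw [h.curvForm_hat hp, hlie, zero_sub, e, h.omega_comb_of_vertical hp]
    · rw [hw 0 (by decide), hb 0 (by decide)]
    · rw [hw 1 (by decide), hb 1 (by decide)]
    · rw [hw 2 (by decide), hb 2 (by decide)]
  rw [hc]
  constructor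
  · intro l hl
    change -w l = 0
    rw [hw l (by rintro rfl; exact absurd hl (by decide)), hb l hl, neg_zero]
  · rintro l (rfl | rfl)
    · exact congrArg Neg.neg (hw 5 (by decide))
    · exact congrArg Neg.neg (hw 6 (by decide))

/-- The curvature function: it only involves the pairs `(t, h₁)` and `(t, h₂)`, with tracefree
values in `ℝi₁ ⊕ ℝi₂ ⊕ ℝj`. -/
theorem IsLeviHypersurface.exists_kappa_eq (h : IsLeviHypersurface φ U) (hp : p ∈ bundle U) :
    ∃ A B : Alg, (∀ l < 5, A l = 0) ∧ (∀ l < 5, B l = 0) ∧ A 5 + B 6 = 0 ∧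
      ∀ x y, kappa φ p x y =
        (x 0 * y 1 - x 1 * y 0) • A + (x 0 * y 2 - x 2 * y 0) • B := by
  obtain ⟨-, b1, b2, tr⟩ := h.bracketCoeff_horizontal hp
  obtain ⟨a1, a1'⟩ := h.curvForm_zero_apply hp (.inl rfl) b1
  obtain ⟨a2, a2'⟩ := h.curvForm_zero_apply hp (.inr rfl) b2
  refine ⟨_, _, a1, a2, ?_, ?_⟩
  · rw [a1' 5 (.inl rfl), a2' 6 (.inr rfl)]
    linear_combination -tr
  intro x y
  have vert : ∀ i : Fin 8, 3 ≤ i → algBasis i ∈ hSub := fun i hi =>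
    Submodule.subset_span ⟨i, by fin_cases i <;> simp [deg] at hi ⊢, rfl⟩
  have z1 : ∀ i j : Fin 8, 3 ≤ i →
      curvForm φ (hat φ (algBasis i)) (hat φ (algBasis j)) p = 0 := fun i j hi =>
    h.curvForm_hat_of_mem_hSub hp (vert i hi) _
  have z2 : ∀ i j : Fin 8, 3 ≤ j →
      curvForm φ (hat φ (algBasis i)) (hat φ (algBasis j)) p = 0 := fun i j hj => by
    rw [h.curvForm_hat_swap hp, z1 j i hj, neg_zero]
  have z0 : ∀ i : Fin 8, curvForm φ (hat φ (algBasis i)) (hat φ (algBasis i)) p = 0 := fun i => by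
    ext k
    have := congrFun (h.curvForm_hat_swap hp (algBasis i) (algBasis i)) k
    exact self_eq_neg.1 this
  have z12 := h.curvForm_one_two hp
  have z21 := h.curvForm_hat_swap hp (algBasis 1) (algBasis 2)
  rw [z12, neg_zero] at z21
  have z10 := h.curvForm_hat_swap hp (algBasis 0) (algBasis 1)
  have z20 := h.curvForm_hat_swap hp (algBasis 0) (algBasis 2)
  have e : kappa φ p x y = ∑ i, x i • ∑ j, y j •
      curvForm φ (hat φ (algBasis i)) (hat φ (algBasis j)) p := by
    rw [kappa, Module.Basis.constr_apply_fintype, LinearMap.sum_apply]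
    refine Finset.sum_congr rfl fun i _ => ?_
    rw [LinearMap.smul_apply, Module.Basis.constr_apply_fintype]
    rfl
  rw [e]
  simp only [Fin.sum_univ_eight, z0, z12, z21, z10, z20, z1 3 _ (by decide), z1 4 _ (by decide),
    z1 5 _ (by decide), z1 6 _ (by decide), z1 7 _ (by decide), z2 _ 3 (by decide),
    z2 _ 4 (by decide), z2 _ 5 (by decide), z2 _ 6 (by decide), z2 _ 7 (by decide)]
  module

/-- For bilinear maps of this shape, homogeneous components are components of the values. -/
theorem homog_apply {Ψ : Cochain} {A B : Alg}
    (hΨ : ∀ x y, Ψ x y = (x 0 * y 1 - x 1 * y 0) • A + (x 0 * y 2 - x 2 * y 0) • B)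
    (h : ℤ) (x y : Alg) : homog Ψ h x y = (x 0 * y 1 - x 1 * y 0) • gradeProj (h - 3) A
      + (x 0 * y 2 - x 2 * y 0) • gradeProj (h - 3) B := by
  have g : ∀ (i : ℤ) (z : Alg) (k : Fin 8), gradeProj i z k = if deg k = i then z k else 0 :=
    fun _ _ _ => rfl
  have h1 : (-2 : ℤ) + -1 + h = h - 3 := by ring
  have h2 : (-1 : ℤ) + -2 + h = h - 3 := by ring
  rw [homog, Finset.sum_pair (by decide), Finset.sum_pair (by decide), Finset.sum_pair (by decide)]
  simp only [LinearMap.add_apply, LinearMap.compr₂_apply, LinearMap.compl₁₂_apply, hΨ, map_add,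
    map_smul, h1, h2, g, deg, Matrix.cons_val, Fin.isValue]
  norm_num
  module

/-- The bracket of `j` with `𝔤₁ ⊕ 𝔤₂` vanishes, and `Ψ(h₁, h₂) = 0`. In the second sum, `[vᵢ*, z]`
with `z ∈ 𝔤₋` meets `𝔤₋` only for `vᵢ* ∈ 𝔤₁` and `z` along `t`, where it lies in `𝔤₋₁`, as does
`vᵢ`, so that sum vanishes. What is left is `[i₂, A] - [i₁, B]`, up to a factor, for `z = t`: a
multiple of `(A 5 + B 6) j`. -/
theorem codiff_eq_zero {Ψ : Cochain} {A B : Alg}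
    (hΨ : ∀ x y, Ψ x y = (x 0 * y 1 - x 1 * y 0) • A + (x 0 * y 2 - x 2 * y 0) • B)
    (hA : ∀ l < 5, A l = 0) (hB : ∀ l < 5, B l = 0) (hAB : A 5 + B 6 = 0) (z : Alg) :
    codiff Ψ z = 0 := by
  have g : ∀ (z : Alg) (k : Fin 8), projMinus z k = if deg k < 0 then z k else 0 :=
    fun _ _ => rfl
  have A0 := hA 0 (by decide)
  have A1 := hA 1 (by decide)
  have A2 := hA 2 (by decide)
  have A3 := hA 3 (by decide)
  have A4 := hA 4 (by decide)
  have B0 := hB 0 (by decide)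
  have B1 := hB 1 (by decide)
  have B2 := hB 2 (by decide)
  have B3 := hB 3 (by decide)
  have B4 := hB 4 (by decide)
  have B6 : B 6 = -A 5 := by linear_combination hAB
  ext k
  simp only [codiff, Fin.sum_univ_three, hΨ, g]
  fin_cases k <;>
    simp [vDual, vMinus, lie_apply, deg, Alg.neg_apply, A0, A1, A2, A3, A4, B0, B1, B2, B3, B4, B6]
  ring

end CartanTanaka

/-! ### Assembly: isomorphism, regularity of the fields, equivariance, curvature, normality -/

theorem mainTheorem9 (φ : CartanTanaka.Base → ℝ) (U : Set CartanTanaka.Base) (hU : IsOpen U)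
    (hφ : ContDiffOn ℝ 6 φ U)
    (hLevi : ∀ q ∈ U, CartanTanaka.LeviNondegenerateAt φ q) :
    -- `ω_p` is an isomorphism with inverse `ω_p⁻¹`, whose matrix has determinant `(c² + d²)²`
    (∀ p ∈ CartanTanaka.bundle U,
      Function.Bijective (CartanTanaka.omega φ p) ∧
      (∀ x, CartanTanaka.omega φ p (CartanTanaka.omegaInv φ p x) = x) ∧
      (∀ v, CartanTanaka.omegaInv φ p (CartanTanaka.omega φ p v) = v) ∧
      ∃ B : Module.Basis (Fin 8) ℝ CartanTanaka.Tot,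
        (∀ k, B k = CartanTanaka.frame φ p k) ∧
        (LinearMap.toMatrix CartanTanaka.algBasis B (CartanTanaka.omegaInv φ p)).det
          = (p 5 ^ 2 + p 6 ^ 2) ^ 2) ∧
    -- regularity of the constant fields: all components are continuously differentiable, except
    -- for the `∂ₑ`-component of `T̂`, which is continuous, and continuously differentiable as
    -- soon as `φ` has seven continuous derivatives
    (∀ k l : Fin 8, (k, l) ≠ (0, 7) → ContDiffOn ℝ 1
      (fun p => CartanTanaka.hat φ (CartanTanaka.algBasis k) p l) (CartanTanaka.bundle U)) ∧
    ContinuousOn (fun p => CartanTanaka.hat φ (CartanTanaka.algBasis 0) p 7)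
      (CartanTanaka.bundle U) ∧
    (ContDiffOn ℝ 7 φ U → ContDiffOn ℝ 1
      (fun p => CartanTanaka.hat φ (CartanTanaka.algBasis 0) p 7) (CartanTanaka.bundle U)) ∧
    -- `ω` is a Cartan connection: it reproduces the fundamental (vertical) fields and is
    -- infinitesimally equivariant
    (∀ p ∈ CartanTanaka.bundle U,
      (∀ k : Fin 8, 3 ≤ k →
        CartanTanaka.omega φ p (CartanTanaka.frame φ p k) = CartanTanaka.algBasis k) ∧
      ∀ x ∈ CartanTanaka.hSub, ∀ y : CartanTanaka.Alg,
        CartanTanaka.lieBr (CartanTanaka.hat φ x) (CartanTanaka.hat φ y) p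
          = CartanTanaka.hat φ ⁅x, y⁆ p) ∧
    -- `κ(p)` is an alternating form on `𝔤/𝔥` without components of nonpositive homogeneity
    (∀ p ∈ CartanTanaka.bundle U,
      (∀ x, CartanTanaka.kappa φ p x x = 0) ∧
      (∀ x ∈ CartanTanaka.hSub, CartanTanaka.kappa φ p x = 0) ∧
      ∀ h : ℤ, h ≤ 0 → CartanTanaka.homog (CartanTanaka.kappa φ p) h = 0) ∧
    -- normality
    CartanTanaka.IsNormal φ U := by
  have h : CartanTanaka.IsLeviHypersurface φ U := ⟨hU, hφ, hLevi⟩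
  have c0 := h.contDiffOn_alpha (n := 0) (by exact_mod_cast hφ)
  refine ⟨fun p hp => ⟨⟨?_, ?_⟩, h.omega_omegaInv hp, h.omegaInv_omega hp, h.exists_basis hp⟩,
    fun k l hkl => ?_, ?_, fun h7 => ?_, fun p hp => ⟨fun k => h.omega_frame hp,
    fun x hx y => h.lieBr_hat_of_mem_hSub hp hx y⟩, fun p hp => ?_, fun p hp n _ z _ => ?_⟩
  · exact Function.LeftInverse.injective (h.omegaInv_omega hp)
  · exact Function.RightInverse.surjective (h.omega_omegaInv hp)
  · rw [CartanTanaka.hat_algBasis]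
    refine h.contDiffOn_comb (n := 1) (by norm_num) fun i hi => (c0 k i).2 fun ⟨hk, hi'⟩ => hkl ?_
    rw [hk, hi hi']
  · rw [CartanTanaka.hat_algBasis]
    exact (h.contDiffOn_comb (n := 0) (by norm_num) fun i _ => (c0 0 i).1).continuousOn
  · rw [CartanTanaka.hat_algBasis]
    exact h.contDiffOn_comb (n := 1) (by norm_num) fun i _ =>
      (h.contDiffOn_alpha (n := 1) (by exact_mod_cast h7) 0 i).1
  · obtain ⟨A, B, hA, hB, -, hκ⟩ := h.exists_kappa_eq hp
    refine ⟨fun x => ?_, fun x hx => ?_, fun n hn => ?_⟩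
    · rw [hκ, mul_comm (x 1), mul_comm (x 2), sub_self, sub_self, zero_smul, zero_smul, add_zero]
    · obtain ⟨x0, x1, x2⟩ := CartanTanaka.apply_eq_zero_of_mem_hSub hx
      refine LinearMap.ext fun y => ?_
      rw [hκ, x0, x1, x2]
      simp
    -- The pairs `(t, hᵢ)` have degree `-3`, so the values would have degree `n - 3 ≤ -3`, below the
    -- lowest degree `-2` of `𝔤`.
    · have hg : ∀ z : CartanTanaka.Alg, CartanTanaka.gradeProj (n - 3) z = 0 := fun z => by
        ext k
        refine if_neg ?_
        have : -2 ≤ CartanTanaka.deg k := by fin_cases k <;> decide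
        omega
      refine LinearMap.ext₂ fun x y => ?_
      rw [CartanTanaka.homog_apply hκ, hg, hg]
      simp
  · obtain ⟨A, B, hA, hB, hAB, hκ⟩ := h.exists_kappa_eq hp
    have hg : ∀ (z : CartanTanaka.Alg) (k : Fin 8), CartanTanaka.gradeProj (n - 3) z k =
        if CartanTanaka.deg k = n - 3 then z k else 0 := fun _ _ => rfl
    refine CartanTanaka.codiff_eq_zero (CartanTanaka.homog_apply hκ n) (fun l hl => ?_)
      (fun l hl => ?_) ?_ z
    · rw [hg, hA l hl, ite_self]
    · rw [hg, hB l hl, ite_self]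
    · rw [hg, hg]
      -- Both `i₁` and `i₂` have degree 1, so passing to a homogeneous component keeps both terms of
      -- the trace or drops both.
      change (if (1 : ℤ) = n - 3 then A 5 else 0) + (if (1 : ℤ) = n - 3 then B 6 else 0) = 0
      split_ifs
      · exact hAB
      · exact add_zero 0
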